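/- **Definitions.** For positive integers $r,s,t$ let $K_{r,s,t}$ be the poset with $r$ bottom, $s$ middle and $t$ top elements in which $x<y$ if and only if $x$ lies on a strictly lower level than $y$. A family $\mathcal F\subseteq 2^{[n]}$ is $P$-free if there is no injection $i:P\to\mathcal F$ such that $p\le q$ implies $i(p)\subseteq i(q)$; $La(n,P)$ is the maximum size of a $P$-free family $\mathcal F\subseteq 2^{[n]}$. Let $\pi(P)=\lim_{n\to\infty} La(n,P)/\binom{n}{\lfloor n/2\rfloor}$ (if the limit exists), and let $e(P)$ be the largest $k$ such that for all $j$ and $n$ the family $\bigcup_{i=1}^{k}\binom{[n]}{j+i}$ is $P$-free. Let $\Sigma(n,k)=\sum_{i=1}^{k}\binom{n}{\lfloor (n-k)/2\rfloor+i}$, where $\binom{n}{j}=0$ for $j<0$, and $z^+=\max\{0,z\}$. Let $f(r,t)=0$ if $r=t=1$, $f(r,t)=1$ if exactly one of $r,t$ equals $1$, and $f(r,t)=2$ if $r,t\ge 2$. Finally, let $m_s=\lceil\log_2(s-f(r,t)+2)\rceil$. **Theorem.** Let $r,t\ge 1$ and $s$ be integers with $s-f(r,t)\ge 2$. All implied constants,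 rates and thresholds below may depend on $r,s,t$. (1) If $s-f(r,t)\in\left[2^{m_s-1}-1,\;2^{m_s}-\binom{m_s}{\lceil m_s/2\rceil}-1\right]$, then $\pi(K_{r,s,t})$ exists and $\pi(K_{r,s,t})=e(K_{r,s,t})=m_s+f(r,t)$. Moreover, for all $n\ge1$, $$\Sigma(n,m_s+f(r,t))+\left(\frac{(r-2)^++(t-2)^+}{n}-O\!\left(\frac1{n^2}\right)\right)\binom{n}{\lceil n/2\rceil}\le La(n,K_{r,s,t})\le\left(m_s+f(r,t)+\frac{2(r+t-2)}{n}+o\!\left(\frac1n\right)\right)\binom{n}{\lceil n/2\rceil}.$$ (2) If $s-f(r,t)\in\left[2^{m_s}-\binom{m_s}{\lceil m_s/2\rceil},\;2^{m_s}-2\right]$, then for all $n\ge 1$ $$\Sigma(n,m_s+f(r,t))+\left(\frac{(r-2)^++(t-2)^+}{n}-O\!\left(\frac1{n^2}\right)\right)\binom{n}{\lceil n/2\rceil}\le La(n,K_{r,s,t}),$$ and for all sufficiently large $n$ $$La(n,K_{r,s,t})\le\left(m_s+f(r,t)+1-\frac{2^{m_s}-s+f(r,t)-1}{\binom{m_s}{\lceil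 m_s/2\rceil}}\right)\binom{n}{\lceil n/2\rceil}.$$ -/

import Mathlib

open Filter Topology Asymptotics

/-- The underlying type of the complete multilevel poset whose `i`-th level has `c i` elements
(levels are listed from bottom to top). -/
def MultilevelPoset {k : ℕ} (c : Fin k → ℕ) : Type := Σ i : Fin k, Fin (c i)

/-- An element lies strictly below another one exactly when its level is strictly lower;
distinct elements of the same level are incomparable. -/
instance {k : ℕ} (c : Fin k → ℕ) : PartialOrder (MultilevelPoset c) where
  le a b := a = b ∨ a.1 < b.1
  le_refl _ := Or.inl rfl
  le_trans a b d hab hbd := by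
    rcases hab with rfl | h
    · exact hbd
    · rcases hbd with rfl | h'
      · exact Or.inr h
      · exact Or.inr (lt_trans h h')
  le_antisymm a b hab hba := by
    rcases hab with rfl | h
    · rfl
    · rcases hba with h' | h'
      · exact h'.symm
      · exact absurd (lt_trans h h') (lt_irrefl _)

/-- The complete three-level poset `K_{r,s,t}`: `r` elements at the bottom, `s` in the middle and
`t` at the top. -/
abbrev K (r s t : ℕ) : Type := MultilevelPoset ![r, s, t]

/-- The family `F` of subsets of an `n`-element set, ordered by inclusion, contains the poset `P`
(not necessarily as an induced subposet): there is an order-preserving injection `P → F`. -/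
def ContainsPoset {n : ℕ} (F : Finset (Finset (Fin n))) (P : Type) [PartialOrder P] : Prop :=
  ∃ i : P → {A : Finset (Fin n) // A ∈ F},
    Function.Injective i ∧ ∀ p q : P, p ≤ q → (i p : Finset (Fin n)) ⊆ (i q : Finset (Fin n))

/-- The family `F` is `P`-free. -/
def PosetFree {n : ℕ} (F : Finset (Finset (Fin n))) (P : Type) [PartialOrder P] : Prop :=
  ¬ ContainsPoset F P

open Classical in
/-- `La(n, P)`: the maximum size of a `P`-free family of subsets of an `n`-element set. -/
noncomputable def La (n : ℕ) (P : Type) [PartialOrder P] : ℕ :=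
  (Finset.univ.filter fun F : Finset (Finset (Fin n)) => PosetFree F P).sup Finset.card

/-- The union of the `k` consecutive levels `j + 1, …, j + k` of the Boolean lattice
(levels outside `0, …, n` are empty). -/
def consecutiveLevels (n : ℕ) (j : ℤ) (k : ℕ) : Finset (Finset (Fin n)) :=
  Finset.univ.filter fun A => j + 1 ≤ (A.card : ℤ) ∧ (A.card : ℤ) ≤ j + k

/-- `e(P)` exists and equals `k`: it is the largest `k` such that, for all `j` and `n`, the `k`
consecutive levels `j + 1, …, j + k` of the Boolean lattice of order `n` form a `P`-free family. -/
def HasE (P : Type) [PartialOrder P] (k : ℕ) : Prop :=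
  IsGreatest {k : ℕ | ∀ (j : ℤ) (n : ℕ), PosetFree (consecutiveLevels n j k) P} k

/-- `π(P)`, the limit of `La(n, P) / binom(n, ⌊n/2⌋)`, exists and equals `x`. -/
def HasPi (P : Type) [PartialOrder P] (x : ℝ) : Prop :=
  Tendsto (fun n : ℕ => (La n P : ℝ) / (n.choose (n / 2) : ℝ)) atTop (𝓝 x)

/-- The binomial coefficient with an integer lower index, zero when that index is negative. -/
def chooseInt (n : ℕ) (j : ℤ) : ℕ := if 0 ≤ j then n.choose j.toNat else 0

/-- `Σ(n, k) = ∑_{i = 1}^{k} binom(n, ⌊(n - k) / 2⌋ + i)`, the sum of the `k` largest binomial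
coefficients of order `n` (integer division by `2` is the floor, also for negative numbers). -/
def sigmaSum (n k : ℕ) : ℕ :=
  ∑ i ∈ Finset.Icc 1 k, chooseInt n (((n : ℤ) - (k : ℤ)) / 2 + (i : ℤ))

/-- `f(r, t)` for positive `r, t`: `0` if `r = t = 1`, `1` if exactly one of them is `1`, and `2`
if both are at least `2`. -/
def f (r t : ℕ) : ℕ := if r = 1 ∧ t = 1 then 0 else if r = 1 ∨ t = 1 then 1 else 2

/-- `m_s = ⌈log₂ (s - f(r, t) + 2)⌉`. As `f(r, t) ≤ 2`, the subtraction never truncates. -/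
def mS (r s t : ℕ) : ℕ := Nat.clog 2 (s + 2 - f r t)

/-- `mS` is the ceiling of the real binary logarithm. -/
theorem mS_eq_ceil_logb (r s t : ℕ) :
    (mS r s t : ℤ) = ⌈Real.logb 2 ((s : ℝ) - (f r t : ℝ) + 2)⌉ := by
  have hf : f r t ≤ 2 := by unfold f; split_ifs <;> omega
  have h : ((s + 2 - f r t : ℕ) : ℝ) = (s : ℝ) - (f r t : ℝ) + 2 := by
    rw [Nat.cast_sub (by omega)]; push_cast; ring
  have h2 := Real.ceil_logb_natCast (b := 2) (r := ((s + 2 - f r t : ℕ) : ℝ)) (Nat.cast_nonneg _)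
  rw [← h]
  push_cast at h2
  rw [h2, Int.clog_natCast]
  rfl

/-- The lower bound `Σ(n, k) + (((r-2)⁺ + (t-2)⁺)/n - O(1/n²)) binom(n, ⌈n/2⌉) ≤ La(n, K_{r,s,t})`
for all `n ≥ 1`. -/
def LowerBound (r s t k : ℕ) : Prop :=
  ∃ C : ℝ, ∀ n : ℕ, 1 ≤ n →
    (sigmaSum n k : ℝ)
        + ((max 0 ((r : ℝ) - 2) + max 0 ((t : ℝ) - 2)) / (n : ℝ) - C / (n : ℝ) ^ 2)
          * (n.choose ((n + 1) / 2) : ℝ)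
      ≤ (La n (K r s t) : ℝ)

/-! Write `m` for `mS r s t`, `f` for `f r t`, `M` for the middle binomial coefficient of order `m`,
and `h = 2 ^ m - 1 - (s - f)`.

Upper bound. Split a `K_{r,s,t}`-free family into the members with fewer than `r` members below them
(only if `r ≠ 1`), those with fewer than `t` above them (only if `t ≠ 1`), and the rest `H`. A
random maximal chain, conditioned on its greatest member in the low part, meets on average only
about `2 * (r - 1) / n` further members of it, so the low part has about one full level; the high
part is dual. Together they account for `f` and for the term `2 * (r + t - 2) / n`. In `H`, fewer
than `s - f` members lie strictly between two members `A ⊂ B`, since otherwise `A`, `B` and the sets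
below and above them complete a copy of `K_{r,s,t}` (`card_Ioo_inter_add_le`).

To bound `H`, group the maximal chains by their least and greatest members `A`, `B` in `H`. Within a
group the chain is uniform on the interval from `A` to `B`, so the average number of members met is
the Lubell function of `H` on that interval. With at most `2 ^ m - 2 - h` inner sets, this is at
most `max m (m + 1 - h / M)` (`lubell_le_max`): the second value is that of a Boolean lattice of
rank `m` missing `h` sets of a middle level. If `h ≥ M` the bound is `m`, which is part (1).

If `h < M` the bound is the constant of part (2), with no room for the `O(1 / n)` coming from the
low and high parts. A constant gain is found by showing that the extremal intervals cannot dominate: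
by injectivity of the inclusion matrix of `u`-sets against `m`-sets, above every `A` a fixed
proportion of the rank `m` intervals is not extremal (`exists_not_middle_regular`,
`card_le_of_card_Ioo_inter_le`).

Lower bound. Take `m + f` central levels, and in the two adjacent levels the sets whose element sum
modulo `n` lies in a window of `r - 2`, respectively `t - 2`, residues. In a copy of `K_{r,s,t}` the
union of the bottom and the intersection of the top would differ in size by at most `m - 1`, too
little for `s` middle sets (`posetFree_extendedLevels`). Squeezing gives the limit, and the limit
excludes `m + f + 1` free levels. -/

open Finset in
/-- Two equinumerous subsets of `U` are exchanged by a permutation that fixes everything outside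
`U`. -/
lemma exists_perm_map_eq {α : Type*} [Fintype α] [DecidableEq α] {U E E' : Finset α}
    (hE : E ⊆ U) (hE' : E' ⊆ U) (h : #E = #E') :
    ∃ π : Equiv.Perm α, (∀ x ∉ U, π x = x) ∧ ∀ x, x ∈ E ↔ π x ∈ E' := by
  obtain ⟨e⟩ : Nonempty ({x : U // (x : α) ∈ E} ≃ {x : U // (x : α) ∈ E'}) := by
    refine Fintype.card_eq.1 ?_
    have key : ∀ E : Finset α, E ⊆ U → Fintype.card {x : U // (x : α) ∈ E} = #E := by
      intro E hE
      rw [Fintype.card_subtype]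
      refine Finset.card_bij (fun x _ => (x : α)) (by simp) (by simp) ?_
      intro b hb
      exact ⟨⟨b, hE hb⟩, by simpa using hb, rfl⟩
    rw [key E hE, key E' hE', h]
  refine ⟨Equiv.Perm.ofSubtype e.extendSubtype, ?_, ?_⟩
  · intro x hx
    exact Equiv.Perm.ofSubtype_apply_of_not_mem _ hx
  · intro x
    by_cases hx : x ∈ U
    · rw [Equiv.Perm.ofSubtype_apply_of_mem _ hx]
      constructor
      · intro hxE
        exact e.extendSubtype_mem ⟨x, hx⟩ hxE
      · intro hxE
        by_contra hcon
        exact e.extendSubtype_not_mem ⟨x, hx⟩ hcon hxE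
    · rw [Equiv.Perm.ofSubtype_apply_of_not_mem _ hx]
      exact ⟨fun h => absurd (hE h) hx, fun h => absurd (hE' h) hx⟩

/-! ### Maximal chains as numberings, and their grouping into blocks. -/

section Chains

open Finset Numbering

variable {α : Type*} [Fintype α]

lemma Numbering.isPrefix_trans {π : Equiv.Perm α} {f : Numbering α} {s t : Finset α}
    (h : ∀ x, x ∈ s ↔ π x ∈ t) : IsPrefix (π.trans f) s ↔ IsPrefix f t := by
  classical
  have hst : s.map π.toEmbedding = t := by
    ext y
    simp only [Finset.mem_map_equiv, h, Equiv.apply_symm_apply]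
  have hc : #s = #t := by rw [← hst, Finset.card_map]
  constructor
  · intro hs y
    have := hs (π.symm y)
    rw [h] at this
    simpa [hc] using this
  · intro ht x
    rw [h, ht, hc]
    rfl

/-- The initial segment of length `j` of a numbering. -/
def Numbering.initial (f : Numbering α) (j : ℕ) : Finset α := univ.filter fun x => (f x : ℕ) < j

lemma Numbering.card_initial (f : Numbering α) {j : ℕ} (hj : j ≤ Fintype.card α) :
    #(f.initial j) = j := by
  have : (f.initial j).map f.toEmbedding = univ.filter fun i : Fin (Fintype.card α) => (i : ℕ) < j := by
    ext y
    simp [Numbering.initial, Finset.mem_map_equiv]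
  rw [← Finset.card_map f.toEmbedding, this, Fin.card_filter_val_lt]
  omega

lemma Numbering.isPrefix_initial (f : Numbering α) {j : ℕ} (hj : j ≤ Fintype.card α) :
    IsPrefix f (f.initial j) := by
  intro x
  rw [f.card_initial hj]
  simp [Numbering.initial]

lemma Numbering.IsPrefix.eq_initial {f : Numbering α} {s : Finset α} (h : IsPrefix f s) :
    s = f.initial #s := by
  ext x
  simp [Numbering.initial, h x]

lemma Numbering.isPrefix_empty (f : Numbering α) : IsPrefix f ∅ := by
  intro x; simp

lemma Numbering.isPrefix_univ (f : Numbering α) : IsPrefix f univ := by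
  intro x; simp

variable [DecidableEq α]

/-- The numberings with prefixes `A` and `B` all of whose prefixes belonging to `H` lie
between `A` and `B`. -/
def block (H : Finset (Finset α)) (A B : Finset α) : Finset (Numbering α) :=
  univ.filter fun f => IsPrefix f A ∧ IsPrefix f B ∧ ∀ D ∈ H, IsPrefix f D → A ⊆ D ∧ D ⊆ B

lemma mem_block {H : Finset (Finset α)} {A B : Finset α} {f : Numbering α} :
    f ∈ block H A B ↔ IsPrefix f A ∧ IsPrefix f B ∧ ∀ D ∈ H, IsPrefix f D → A ⊆ D ∧ D ⊆ B := by
  simp [block]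

/-- Prefixes of one numbering form a chain, so each lies below `A`, above `B` or between them. A
permutation supported on `B \ A` preserves all sets of the first two kinds, and those of the third
kind are unrestricted in a block. This symmetry is the source of uniformity. -/
lemma trans_mem_block {H : Finset (Finset α)} {A B : Finset α} {f : Numbering α}
    (hf : f ∈ block H A B) {π : Equiv.Perm α} (hπ : ∀ x ∉ B \ A, π x = x) :
    π.trans f ∈ block H A B := by
  have hinj : ∀ x, π x ∈ B \ A → x ∈ B \ A := by
    intro x hx
    by_contra hcon
    rw [hπ x hcon] at hx
    exact hcon hx
  have hfix : ∀ x, x ∈ B \ A → π x ∈ B \ A := by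
    intro x hx
    by_contra hcon
    have h1 := hπ _ hcon
    have h2 := π.injective h1
    rw [h2] at hcon
    exact hcon hx
  have hsmall : ∀ D : Finset α, D ⊆ A → ∀ x, x ∈ D ↔ π x ∈ D := by
    intro D hD x
    constructor
    · intro hx
      rw [hπ x (by simp [hD hx])]; exact hx
    · intro hx
      have h1 : x ∉ B \ A := fun h => (mem_sdiff.1 (hfix x h)).2 (hD hx)
      rwa [hπ x h1] at hx
  have hbig : ∀ D : Finset α, B ⊆ D → ∀ x, x ∈ D ↔ π x ∈ D := by
    intro D hD x
    by_cases hx : x ∈ B \ A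
    · exact iff_of_true (hD (mem_sdiff.1 hx).1) (hD (mem_sdiff.1 (hfix x hx)).1)
    · rw [hπ x hx]
  rw [mem_block] at hf ⊢
  obtain ⟨h1, h2, h3⟩ := hf
  have h1' : IsPrefix (π.trans f) A := (isPrefix_trans (hsmall A subset_rfl)).2 h1
  have h2' : IsPrefix (π.trans f) B := (isPrefix_trans (hbig B subset_rfl)).2 h2
  refine ⟨h1', h2', fun D hD hDf => ?_⟩
  rcases le_total #D #A with h | h
  · have hDA := hDf.subset_of_card_le_card h1' h
    exact h3 D hD ((isPrefix_trans (hsmall D hDA)).1 hDf)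
  · rcases le_total #B #D with h' | h'
    · have hBD := h2'.subset_of_card_le_card hDf h'
      exact h3 D hD ((isPrefix_trans (hbig D hBD)).1 hDf)
    · exact ⟨h1'.subset_of_card_le_card hDf h, hDf.subset_of_card_le_card h2' h'⟩

/-- The number of sets of size `k` between `A` and `B`. -/
lemma card_filter_between {A B : Finset α} (hAB : A ⊆ B) {k : ℕ} (hk : #A ≤ k) :
    #(univ.filter fun D => A ⊆ D ∧ D ⊆ B ∧ #D = k) = (#B - #A).choose (k - #A) := by
  rw [← card_sdiff_of_subset hAB, ← card_powersetCard]
  refine card_bij' (fun D' _ => D' \ A) (fun E _ => A ∪ E) ?_ ?_ ?_ ?_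
  · intro D' hD'
    simp only [mem_filter, mem_univ, true_and] at hD'
    rw [mem_powersetCard]
    refine ⟨sdiff_subset_sdiff hD'.2.1 subset_rfl, ?_⟩
    rw [card_sdiff_of_subset hD'.1, hD'.2.2]
  · intro E hE
    rw [mem_powersetCard] at hE
    simp only [mem_filter, mem_univ, true_and]
    refine ⟨subset_union_left, union_subset hAB (hE.1.trans sdiff_subset), ?_⟩
    rw [card_union_of_disjoint, hE.2]
    · omega
    · exact disjoint_of_subset_right hE.1 disjoint_sdiff
  · intro D' hD'
    simp only [mem_filter, mem_univ, true_and] at hD'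
    exact union_sdiff_of_subset hD'.1
  · intro E hE
    rw [mem_powersetCard] at hE
    exact union_sdiff_cancel_left (disjoint_of_subset_right hE.1 disjoint_sdiff)

/-- In a block, the prefix of each size between `A` and `B` is uniformly distributed. -/
lemma card_block_filter_mul (H : Finset (Finset α)) {A B D : Finset α} (hAD : A ⊆ D) (hDB : D ⊆ B) :
    #((block H A B).filter fun f => IsPrefix f D) * (#B - #A).choose (#D - #A)
      = #(block H A B) := by
  have hAB := hAD.trans hDB
  -- Double counting between the block and `S`: every set of `S` is a prefix equally often by
  -- symmetry, and every numbering of the block has exactly one prefix in `S`.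
  set S : Finset (Finset α) := univ.filter fun D' => A ⊆ D' ∧ D' ⊆ B ∧ #D' = #D with hS
  have hcardS : #S = (#B - #A).choose (#D - #A) := card_filter_between hAB (card_le_card hAD)
  have hsame : ∀ D' ∈ S, #((block H A B).filter fun f => IsPrefix f D')
      = #((block H A B).filter fun f => IsPrefix f D) := by
    intro D' hD'
    simp only [hS, mem_filter, mem_univ, true_and] at hD'
    obtain ⟨hAD', hD'B, hc⟩ := hD'
    obtain ⟨π, hπ, hmap⟩ := exists_perm_map_eq (U := B \ A) (E := D' \ A) (E' := D \ A)
      (sdiff_subset_sdiff hD'B subset_rfl) (sdiff_subset_sdiff hDB subset_rfl)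
      (by rw [card_sdiff_of_subset hAD, card_sdiff_of_subset hAD', hc])
    have hmap' : ∀ x, x ∈ D' ↔ π x ∈ D := by
      intro x
      by_cases hxA : x ∈ A
      · rw [hπ x (by simp [hxA])]
        exact iff_of_true (hAD' hxA) (hAD hxA)
      · have hπA : π x ∉ A := by
          intro h
          have h1 : π (π x) = π x := hπ _ (by simp [h])
          rw [π.injective h1] at h
          exact hxA h
        have := hmap x
        simpa [hxA, hπA] using this
    have hπ' : ∀ x ∉ B \ A, π.symm x = x := by
      intro x hx
      rw [Equiv.symm_apply_eq, hπ x hx]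
    refine card_bij' (fun f _ => π.symm.trans f) (fun f _ => π.trans f) ?_ ?_ ?_ ?_
    · intro f hf
      rw [mem_filter] at hf ⊢
      refine ⟨trans_mem_block hf.1 hπ', (isPrefix_trans ?_).2 hf.2⟩
      intro x
      rw [hmap', Equiv.apply_symm_apply]
    · intro f hf
      rw [mem_filter] at hf ⊢
      exact ⟨trans_mem_block hf.1 hπ, (isPrefix_trans hmap').2 hf.2⟩
    · intro f _; ext x; simp
    · intro f _; ext x; simp
  have hone : ∀ f ∈ block H A B, #(S.filter fun D' => IsPrefix f D') = 1 := by
    intro f hf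
    rw [mem_block] at hf
    rw [card_eq_one]
    have hle : #D ≤ Fintype.card α := card_le_univ D
    refine ⟨f.initial #D, ?_⟩
    ext D'
    simp only [hS, mem_filter, mem_univ, true_and, mem_singleton]
    constructor
    · rintro ⟨⟨_, _, hc⟩, hp⟩
      rw [hp.eq_initial, hc]
    · rintro rfl
      have hc := f.card_initial hle
      have hp := f.isPrefix_initial hle
      refine ⟨⟨hf.1.subset_of_card_le_card hp ?_, hp.subset_of_card_le_card hf.2.1 ?_, hc⟩, hp⟩
      · rw [hc]; exact card_le_card hAD
      · rw [hc]; exact card_le_card hDB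
  have hdc := sum_card_bipartiteAbove_eq_sum_card_bipartiteBelow
    (s := block H A B) (t := S) (fun f D' => IsPrefix f D')
  unfold bipartiteAbove bipartiteBelow at hdc
  rw [sum_congr rfl hone, sum_congr rfl hsame, sum_const, sum_const, hcardS] at hdc
  simp only [smul_eq_mul, mul_one] at hdc
  rw [hdc, mul_comm]

end Chains

lemma Nat.le_choose_of_pos_of_lt {n k : ℕ} (hk : 0 < k) (hkn : k < n) : n ≤ n.choose k := by
  induction n with
  | zero => omega
  | succ n ih =>
    obtain ⟨k, rfl⟩ : ∃ l, k = l + 1 := ⟨k - 1, by omega⟩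
    rw [Nat.choose_succ_succ']
    have h1 : 0 < n.choose k := Nat.choose_pos (by omega)
    rcases (by omega : k + 1 < n ∨ n = k + 1) with h | rfl
    · have := ih h
      omega
    · simp

/-! ### Averaging over blocks: the Lubell function. -/

section Lubell

open Finset Numbering

variable {α : Type*} [Fintype α] [DecidableEq α]

/-- The number of prefixes of `f` that belong to `H`. -/
def chainCount (H : Finset (Finset α)) (f : Numbering α) : ℕ := #(H.filter fun D => IsPrefix f D)

/-- The Lubell function of the part of `H` in the interval between `A` and `B`. -/
noncomputable def lubell (H : Finset (Finset α)) (A B : Finset α) : ℝ :=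
  ∑ D ∈ H.filter fun D => A ⊆ D ∧ D ⊆ B, (1 : ℝ) / ((#B - #A).choose (#D - #A) : ℝ)

lemma block_empty_univ (H : Finset (Finset α)) : block H ∅ univ = univ := by
  ext f
  simp [mem_block, isPrefix_empty, isPrefix_univ]

lemma card_block_filter (H : Finset (Finset α)) {A B D : Finset α} (hAD : A ⊆ D) (hDB : D ⊆ B) :
    (#((block H A B).filter fun f => IsPrefix f D) : ℝ)
      = #(block H A B) * (1 / ((#B - #A).choose (#D - #A) : ℝ)) := by
  have h := card_block_filter_mul H hAD hDB
  have hp : (0 : ℝ) < ((#B - #A).choose (#D - #A) : ℝ) := by 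
    exact_mod_cast Nat.choose_pos (Nat.sub_le_sub_right (card_le_card hDB) _)
  rw [mul_one_div, eq_div_iff hp.ne']
  exact_mod_cast h

/-- In a block every prefix from `H` lies between `A` and `B`, and each such set is hit with
probability the inverse of its binomial coefficient; linearity of expectation does the rest. -/
lemma sum_block_chainCount (H : Finset (Finset α)) (A B : Finset α) :
    ∑ f ∈ block H A B, (chainCount H f : ℝ) = #(block H A B) * lubell H A B := by
  have h1 : ∀ f ∈ block H A B, (chainCount H f : ℝ)
      = ∑ D ∈ H.filter fun D => A ⊆ D ∧ D ⊆ B, if IsPrefix f D then (1 : ℝ) else 0 := by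
    intro f hf
    rw [mem_block] at hf
    rw [sum_boole, chainCount, filter_filter]
    congr 2
    ext D
    simp only [mem_filter]
    constructor
    · rintro ⟨h1, h2⟩; exact ⟨h1, hf.2.2 D h1 h2, h2⟩
    · rintro ⟨h1, -, h2⟩; exact ⟨h1, h2⟩
  rw [sum_congr rfl h1, sum_comm, lubell, mul_sum]
  refine sum_congr rfl fun D hD => ?_
  rw [mem_filter] at hD
  rw [sum_boole, card_block_filter H hD.2.1 hD.2.2]

lemma exists_least_prefix {H : Finset (Finset α)} {f : Numbering α}
    (h : ∃ D ∈ H, IsPrefix f D) :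
    ∃ A ∈ H, IsPrefix f A ∧ ∀ D ∈ H, IsPrefix f D → A ⊆ D := by
  obtain ⟨D, hD, hf⟩ := h
  obtain ⟨A, hA, hmin⟩ := exists_min_image (H.filter fun D => IsPrefix f D) card
    ⟨D, mem_filter.2 ⟨hD, hf⟩⟩
  rw [mem_filter] at hA
  exact ⟨A, hA.1, hA.2, fun D hD hf => hA.2.subset_of_card_le_card hf
    (hmin D (mem_filter.2 ⟨hD, hf⟩))⟩

lemma exists_greatest_prefix {H : Finset (Finset α)} {f : Numbering α}
    (h : ∃ D ∈ H, IsPrefix f D) :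
    ∃ B ∈ H, IsPrefix f B ∧ ∀ D ∈ H, IsPrefix f D → D ⊆ B := by
  obtain ⟨D, hD, hf⟩ := h
  obtain ⟨A, hA, hmax⟩ := exists_max_image (H.filter fun D => IsPrefix f D) card
    ⟨D, mem_filter.2 ⟨hD, hf⟩⟩
  rw [mem_filter] at hA
  exact ⟨A, hA.1, hA.2, fun D hD hf => hf.subset_of_card_le_card hA.2
    (hmax D (mem_filter.2 ⟨hD, hf⟩))⟩

/-- Splitting a sum over numberings according to the least prefix in `H`. -/
lemma sum_eq_sum_block_left (H : Finset (Finset α)) (g : Numbering α → ℝ)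
    (hg : ∀ f, (¬ ∃ D ∈ H, IsPrefix f D) → g f = 0) :
    ∑ f, g f = ∑ A ∈ H, ∑ f ∈ block H A univ, g f := by
  have h1 : ∀ A ∈ H, ∑ f ∈ block H A univ, g f = ∑ f, if f ∈ block H A univ then g f else 0 := by
    intro A _
    rw [sum_ite_mem, univ_inter]
  rw [sum_congr rfl h1, sum_comm]
  refine sum_congr rfl fun f _ => ?_
  by_cases h : ∃ D ∈ H, IsPrefix f D
  · obtain ⟨A, hA, hfA, hmin⟩ := exists_least_prefix h
    rw [sum_eq_single_of_mem A hA, if_pos]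
    · exact mem_block.2 ⟨hfA, isPrefix_univ f, fun D hD hf => ⟨hmin D hD hf, subset_univ _⟩⟩
    · intro A' hA' hne
      rw [if_neg]
      intro hf
      rw [mem_block] at hf
      exact hne (subset_antisymm (hf.2.2 A hA hfA).1 (hmin A' hA' hf.1))
  · rw [hg f h]; simp

/-- Splitting a sum over a block according to the greatest prefix in `H`. -/
lemma sum_block_eq_sum_block (H : Finset (Finset α)) (A : Finset α) (g : Numbering α → ℝ)
    (hg : ∀ f ∈ block H A univ, (¬ ∃ D ∈ H, IsPrefix f D) → g f = 0) :
    ∑ f ∈ block H A univ, g f = ∑ B ∈ H, ∑ f ∈ block H A B, g f := by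
  have h1 : ∀ B ∈ H, ∑ f ∈ block H A B, g f
      = ∑ f ∈ block H A univ, if f ∈ block H A B then g f else 0 := by
    intro B _
    rw [sum_ite_mem]
    refine sum_congr ?_ fun _ _ => rfl
    symm
    rw [inter_eq_right]
    intro f hf
    rw [mem_block] at hf ⊢
    exact ⟨hf.1, isPrefix_univ f, fun D hD h => ⟨(hf.2.2 D hD h).1, subset_univ _⟩⟩
  rw [sum_congr rfl h1, sum_comm]
  refine sum_congr rfl fun f hfb => ?_
  by_cases h : ∃ D ∈ H, IsPrefix f D
  · obtain ⟨B, hB, hfB, hmax⟩ := exists_greatest_prefix h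
    rw [mem_block] at hfb
    rw [sum_eq_single_of_mem B hB, if_pos]
    · exact mem_block.2 ⟨hfb.1, hfB, fun D hD hf => ⟨(hfb.2.2 D hD hf).1, hmax D hD hf⟩⟩
    · intro B' hB' hne
      rw [if_neg]
      intro hf
      rw [mem_block] at hf
      exact hne (subset_antisymm (hmax B' hB' hf.2.1) (hf.2.2 B hB hfB).2)
  · rw [hg f hfb h]; simp

/-- A numbering has only one least prefix in `H`, so these blocks are disjoint. They need not cover:
some chains avoid `H`. -/
lemma sum_card_block_left_le (H : Finset (Finset α)) :
    ∑ A ∈ H, (#(block H A univ) : ℝ) ≤ Fintype.card (Numbering α) := by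
  classical
  have h := sum_eq_sum_block_left H (fun f => if ∃ D ∈ H, IsPrefix f D then (1 : ℝ) else 0)
    (fun f hf => if_neg hf)
  have h2 : ∀ A ∈ H, (#(block H A univ) : ℝ)
      = ∑ f ∈ block H A univ, if ∃ D ∈ H, IsPrefix f D then (1 : ℝ) else 0 := by
    intro A hA
    rw [card_eq_sum_ones, Nat.cast_sum]
    refine sum_congr rfl fun f hf => ?_
    rw [if_pos ⟨A, hA, (mem_block.1 hf).1⟩, Nat.cast_one]
  rw [sum_congr rfl h2, ← h, sum_boole]
  exact_mod_cast card_le_univ _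

lemma sum_card_block_right_le (H : Finset (Finset α)) :
    ∑ B ∈ H, (#(block H ∅ B) : ℝ) ≤ Fintype.card (Numbering α) := by
  classical
  have h := sum_block_eq_sum_block H ∅ (fun f => if ∃ D ∈ H, IsPrefix f D then (1 : ℝ) else 0)
    (fun f _ hf => if_neg hf)
  have h2 : ∀ B ∈ H, (#(block H ∅ B) : ℝ)
      = ∑ f ∈ block H ∅ B, if ∃ D ∈ H, IsPrefix f D then (1 : ℝ) else 0 := by
    intro A hA
    rw [card_eq_sum_ones, Nat.cast_sum]
    refine sum_congr rfl fun f hf => ?_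
    rw [if_pos ⟨A, hA, (mem_block.1 hf).2.1⟩, Nat.cast_one]
  rw [sum_congr rfl h2, ← h, sum_boole]
  exact_mod_cast card_le_univ _

lemma sum_card_block (H : Finset (Finset α)) {A : Finset α} (hA : A ∈ H) :
    ∑ B ∈ H, (#(block H A B) : ℝ) = #(block H A univ) := by
  have h := sum_block_eq_sum_block H A (fun _ => (1 : ℝ))
    (fun f hf hn => absurd ⟨A, hA, (mem_block.1 hf).1⟩ hn)
  simpa using h.symm

lemma chainCount_eq_zero {H : Finset (Finset α)} {f : Numbering α}
    (h : ¬ ∃ D ∈ H, IsPrefix f D) : (chainCount H f : ℝ) = 0 := by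
  simp only [chainCount, Nat.cast_eq_zero, card_eq_zero, filter_eq_empty_iff]
  push Not at h
  exact h

/-- The LYM argument: a set of size `d` is a prefix of a fraction `1 / n.choose d` of all
numberings, which is at least `1 / n.choose (n / 2)`. -/
lemma card_mul_le_sum_chainCount (H : Finset (Finset α)) :
    (#H : ℝ) * Fintype.card (Numbering α)
      ≤ (Fintype.card α).choose (Fintype.card α / 2) * ∑ f, (chainCount H f : ℝ) := by
  have h1 : ∑ f : Numbering α, (chainCount H f : ℝ)
      = ∑ D ∈ H, (Fintype.card (Numbering α) : ℝ) * (1 / ((Fintype.card α).choose #D : ℝ)) := by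
    have : ∀ f ∈ (univ : Finset (Numbering α)), (chainCount H f : ℝ)
        = ∑ D ∈ H, if IsPrefix f D then (1 : ℝ) else 0 := by
      intro f _
      rw [sum_boole, chainCount]
    rw [sum_congr rfl this, sum_comm]
    refine sum_congr rfl fun D _ => ?_
    have h := card_block_filter (∅ : Finset (Finset α)) (empty_subset D) (subset_univ D)
    rw [block_empty_univ] at h
    rw [sum_boole, h]
    simp
  rw [h1, ← mul_sum, mul_left_comm, mul_comm]
  refine mul_le_mul_of_nonneg_left ?_ (Nat.cast_nonneg _)
  rw [mul_sum, card_eq_sum_ones, Nat.cast_sum]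
  refine sum_le_sum fun D _ => ?_
  have hp : (0 : ℝ) < ((Fintype.card α).choose #D : ℝ) := by
    exact_mod_cast Nat.choose_pos (card_le_univ D)
  rw [mul_one_div, Nat.cast_one, one_le_div hp]
  exact_mod_cast Nat.choose_le_middle _ _

/-- A bound for the average number of members of `H` in a chain bounds the size of `H`. -/
lemma card_le_of_sum_chainCount_le {H : Finset (Finset α)} {γ : ℝ}
    (h : ∑ f, (chainCount H f : ℝ) ≤ γ * Fintype.card (Numbering α)) :
    (#H : ℝ) ≤ γ * (Fintype.card α).choose (Fintype.card α / 2) := by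
  have hN : (0 : ℝ) < Fintype.card (Numbering α) := by
    rw [Fintype.card_numbering]; exact_mod_cast Nat.factorial_pos _
  have h1 := card_mul_le_sum_chainCount H
  have h2 := mul_le_mul_of_nonneg_left h
    (Nat.cast_nonneg (α := ℝ) ((Fintype.card α).choose (Fintype.card α / 2)))
  nlinarith

/-- It suffices to average for each least member `A` separately; `0 ≤ γ` takes care of the chains
that avoid `H`. Keeping `A` fixed and `B` free is what later permits averaging over `B`. -/
lemma card_le_of_forall_block_left {H : Finset (Finset α)} {γ : ℝ} (hγ : 0 ≤ γ)
    (h : ∀ A ∈ H, ∑ f ∈ block H A univ, (chainCount H f : ℝ) ≤ γ * #(block H A univ)) :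
    (#H : ℝ) ≤ γ * (Fintype.card α).choose (Fintype.card α / 2) := by
  refine card_le_of_sum_chainCount_le ?_
  rw [sum_eq_sum_block_left H _ fun f hf => chainCount_eq_zero hf]
  refine (sum_le_sum h).trans ?_
  rw [← mul_sum]
  exact mul_le_mul_of_nonneg_left (sum_card_block_left_le H) hγ

lemma sum_block_univ_chainCount (H : Finset (Finset α)) {A : Finset α} :
    ∑ f ∈ block H A univ, (chainCount H f : ℝ) = ∑ B ∈ H, #(block H A B) * lubell H A B := by
  rw [sum_block_eq_sum_block H A _ fun f _ hf => chainCount_eq_zero hf]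
  exact sum_congr rfl fun B _ => sum_block_chainCount H A B

lemma subset_of_block_nonempty {H : Finset (Finset α)} {A B : Finset α} (hB : B ∈ H)
    (h : (block H A B).Nonempty) : A ⊆ B := by
  obtain ⟨f, hf⟩ := h
  rw [mem_block] at hf
  exact (hf.2.2 B hB hf.2.1).1

/-- A family whose Lubell function is at most `γ` on every interval between two of its members
has at most `γ * n.choose (n / 2)` members. -/
lemma card_le_of_lubell_le {H : Finset (Finset α)} {γ : ℝ} (hγ : 0 ≤ γ)
    (h : ∀ A ∈ H, ∀ B ∈ H, A ⊆ B → lubell H A B ≤ γ) :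
    (#H : ℝ) ≤ γ * (Fintype.card α).choose (Fintype.card α / 2) := by
  refine card_le_of_forall_block_left hγ fun A hA => ?_
  rw [sum_block_univ_chainCount, ← sum_card_block H hA, mul_sum]
  refine sum_le_sum fun B hB => ?_
  rcases (block H A B).eq_empty_or_nonempty with he | hne
  · simp [he]
  · rw [mul_comm γ]
    exact mul_le_mul_of_nonneg_left (h A hA B hB (subset_of_block_nonempty hB hne))
      (Nat.cast_nonneg _)

/-- A family in which every member has size at least `b` and contains at most `k` other members
has at most `(1 + k / b) * n.choose (n / 2)` members. -/
lemma card_le_of_card_lower_le {H : Finset (Finset α)} {k : ℕ} {b : ℝ} (hb : 0 < b)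
    (hsize : ∀ A ∈ H, b ≤ #A) (h : ∀ B ∈ H, #(H.filter fun A => A ⊂ B) ≤ k) :
    (#H : ℝ) ≤ (1 + k / b) * (Fintype.card α).choose (Fintype.card α / 2) := by
  refine card_le_of_sum_chainCount_le ?_
  -- Only the greatest member `B` is fixed here: `B` contributes 1 to the Lubell function from `∅`
  -- to `B`, and each of the at most `k` members below it at most `1 / #B`, because its size is
  -- neither `0` nor `#B`.
  rw [← block_empty_univ H, sum_block_univ_chainCount]
  have hk : 0 ≤ 1 + (k : ℝ) / b := by positivity
  refine le_trans ?_ (mul_le_mul_of_nonneg_left (sum_card_block_right_le H) hk)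
  rw [mul_sum]
  refine sum_le_sum fun B hB => ?_
  rw [mul_comm (1 + (k : ℝ) / b)]
  refine mul_le_mul_of_nonneg_left ?_ (Nat.cast_nonneg _)
  have hsplit : (H.filter fun D => ∅ ⊆ D ∧ D ⊆ B) = insert B (H.filter fun A => A ⊂ B) := by
    ext D
    simp only [mem_filter, empty_subset, true_and, mem_insert]
    constructor
    · rintro ⟨h1, h2⟩
      rcases eq_or_ssubset_of_subset h2 with h | h
      · exact Or.inl h
      · exact Or.inr ⟨h1, h⟩
    · rintro (rfl | h)
      · exact ⟨hB, subset_rfl⟩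
      · exact ⟨h.1, h.2.1⟩
  rw [lubell, hsplit, sum_insert (by simp)]
  simp only [card_empty, Nat.sub_zero, Nat.choose_self, Nat.cast_one, div_one]
  gcongr
  calc ∑ D ∈ H.filter fun A => A ⊂ B, (1 : ℝ) / ((#B).choose #D : ℝ)
      ≤ ∑ D ∈ H.filter fun A => A ⊂ B, 1 / b := by
        refine sum_le_sum fun D hD => ?_
        rw [mem_filter] at hD
        have h1 := card_lt_card hD.2
        have h2 : 0 < #D := by
          have := hb.trans_le (hsize D hD.1)
          exact_mod_cast this
        refine one_div_le_one_div_of_le hb ((hsize B hB).trans ?_)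
        exact_mod_cast Nat.le_choose_of_pos_of_lt h2 h1
    _ = #(H.filter fun A => A ⊂ B) * (1 / b) := by rw [sum_const, nsmul_eq_mul]
    _ ≤ k * (1 / b) := by
        gcongr
        exact h B hB
    _ = k / b := by rw [mul_one_div]

end Lubell

/-! ### The excess over the interior levels as a function of the rank. -/

open Finset in
lemma sum_range_succ_le_of_shift {a b : ℕ → ℝ} {j d : ℕ} (hj : j ≤ d) (h0 : a j ≤ 0)
    (h1 : ∀ i < j, a i ≤ b i) (h2 : ∀ i, j ≤ i → a (i + 1) ≤ b i) :
    ∑ i ∈ range (d + 1), a i ≤ ∑ i ∈ range d, b i := by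
  obtain ⟨e, rfl⟩ := Nat.exists_eq_add_of_le hj
  rw [show j + e + 1 = (j + 1) + e by ring, sum_range_add, sum_range_add b, sum_range_succ]
  have h3 : ∑ i ∈ range j, a i ≤ ∑ i ∈ range j, b i :=
    sum_le_sum fun i hi => h1 i (mem_range.1 hi)
  have h4 : ∑ i ∈ range e, a (j + 1 + i) ≤ ∑ i ∈ range e, b (j + i) :=
    sum_le_sum fun i _ => by
      rw [show j + 1 + i = j + i + 1 by ring]
      exact h2 _ (Nat.le_add_right _ _)
  linarith

/-- The largest possible excess of a Lubell sum over the interior levels of a Boolean lattice of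
rank `d`, when each chosen set costs `1 / l`. -/
noncomputable def levelExcess (l : ℝ) (d : ℕ) : ℝ :=
  ∑ i ∈ Finset.range (d - 1), max 0 (1 - (d.choose (i + 1) : ℝ) / l)

lemma levelExcess_term_mono {l : ℝ} (hl : 0 < l) {a b : ℕ} (h : a ≤ b) :
    max 0 (1 - (b : ℝ) / l) ≤ max 0 (1 - (a : ℝ) / l) := by
  have : (a : ℝ) ≤ b := by exact_mod_cast h
  gcongr

/-- By Pascal's rule each coefficient of row `d + 1` dominates both its parents in row `d`. Terms
before the middle are compared with one parent and terms after it with the other; the extra middle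
term vanishes because its coefficient is at least `l`. -/
lemma levelExcess_succ_le {l : ℝ} (hl : 0 < l) {d : ℕ} (hd : 1 ≤ d)
    (h : l ≤ (d.choose (d / 2) : ℝ)) : levelExcess l (d + 1) ≤ levelExcess l d := by
  obtain ⟨e, rfl⟩ := Nat.exists_eq_add_of_le' hd
  unfold levelExcess
  simp only [Nat.add_sub_cancel]
  refine sum_range_succ_le_of_shift (j := (e + 1) / 2) (by omega) ?_ ?_ ?_
  · rw [max_le_iff]
    refine ⟨le_rfl, ?_⟩
    rw [sub_nonpos, one_le_div hl]
    refine h.trans ?_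
    rw [Nat.choose_succ_succ (e + 1)]
    exact_mod_cast Nat.le_add_right _ _
  · intro i _
    refine levelExcess_term_mono hl ?_
    rw [Nat.choose_succ_succ (e + 1)]
    exact Nat.le_add_left _ _
  · intro i _
    refine levelExcess_term_mono hl ?_
    rw [Nat.choose_succ_succ (e + 1) (i + 1)]
    exact Nat.le_add_right _ _

lemma Nat.choose_middle_mono {m d : ℕ} (h : m ≤ d) : m.choose (m / 2) ≤ d.choose (d / 2) :=
  (Nat.choose_le_choose _ h).trans (Nat.choose_le_middle _ _)

lemma levelExcess_le_of_le {m d : ℕ} (hm : 1 ≤ m) (h : m ≤ d) {l : ℝ} (hl : 0 < l)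
    (hlm : l ≤ (m.choose (m / 2) : ℝ)) : levelExcess l d ≤ levelExcess l m := by
  induction d, h using Nat.le_induction with
  | base => exact le_rfl
  | succ d hd ih =>
    refine (levelExcess_succ_le hl (hm.trans hd) (hlm.trans ?_)).trans ih
    exact_mod_cast Nat.choose_middle_mono hd

/-- The comparison of rows is strict already at the singletons: the coefficient grows from `m` to `m
+ 1`, which costs `1 / l` as long as `m + 1 ≤ l`. That inequality fails for `m = 2` and `m = 3`. -/
lemma levelExcess_succ_le_sub {m : ℕ} (hm : 4 ≤ m) :
    levelExcess (m.choose (m / 2)) (m + 1)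
      ≤ levelExcess (m.choose (m / 2)) m - 1 / (m.choose (m / 2) : ℝ) := by
  have hM : m + 1 ≤ m.choose (m / 2) := by
    refine le_trans ?_ (Nat.choose_le_middle 2 m)
    rw [Nat.choose_two_right, Nat.le_div_iff_mul_le two_pos]
    obtain ⟨k, rfl⟩ := Nat.exists_eq_add_of_le hm
    rw [show 4 + k - 1 = k + 3 by omega]
    nlinarith
  obtain ⟨e, rfl⟩ : ∃ e, m = e + 1 := ⟨m - 1, by omega⟩
  set l : ℝ := (((e + 1).choose ((e + 1) / 2) : ℕ) : ℝ) with hl_def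
  have hM' : ((e + 1 : ℕ) : ℝ) + 1 ≤ l := by rw [hl_def]; exact_mod_cast hM
  have hl : 0 < l := by
    have : (0 : ℝ) ≤ ((e + 1 : ℕ) : ℝ) := Nat.cast_nonneg _
    linarith
  unfold levelExcess
  simp only [Nat.add_sub_cancel]
  -- The whole gain `1 / l` is charged to the term `i = 0`.
  have hsum : ∑ i ∈ Finset.range e, (max 0 (1 - ((e + 1).choose (i + 1) : ℝ) / l)
      - if i = 0 then 1 / l else 0)
      = ∑ i ∈ Finset.range e, max 0 (1 - ((e + 1).choose (i + 1) : ℝ) / l) - 1 / l := by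
    rw [Finset.sum_sub_distrib, Finset.sum_ite_eq' , if_pos (Finset.mem_range.2 (by omega))]
  rw [← hsum]
  refine sum_range_succ_le_of_shift (j := (e + 1) / 2) (by omega) ?_ ?_ ?_
  · rw [max_le_iff]
    refine ⟨le_rfl, ?_⟩
    rw [sub_nonpos, one_le_div hl, hl_def]
    rw [Nat.choose_succ_succ (e + 1)]
    exact_mod_cast Nat.le_add_right _ _
  · intro i _
    split_ifs with hi
    · subst hi
      simp only [zero_add, Nat.choose_one_right]
      rw [le_sub_iff_add_le, max_eq_right]
      · refine le_trans ?_ (le_max_right _ _)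
        push_cast
        rw [add_div]
        linarith
      · rw [sub_nonneg, div_le_one hl]
        push_cast at hM' ⊢
        exact hM'
    · rw [sub_zero]
      refine levelExcess_term_mono hl ?_
      rw [Nat.choose_succ_succ (e + 1)]
      exact Nat.le_add_left _ _
  · intro i hi
    rw [if_neg (by omega), sub_zero]
    refine levelExcess_term_mono hl ?_
    rw [Nat.choose_succ_succ (e + 1) (i + 1)]
    exact Nat.le_add_right _ _

lemma Nat.sum_range_choose_interior {m : ℕ} (hm : 1 ≤ m) :
    ∑ i ∈ Finset.range (m - 1), m.choose (i + 1) + 2 = 2 ^ m := by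
  obtain ⟨e, rfl⟩ := Nat.exists_eq_add_of_le' hm
  have h := Nat.sum_range_choose (e + 1)
  rw [Finset.sum_range_succ, Finset.sum_range_succ'] at h
  simp only [Nat.choose_zero_right, Nat.choose_self] at h
  simpa using h

/-- With `l` the largest coefficient of the row no positive part is cut off, and the interior
coefficients add up to `2 ^ m - 2`. -/
lemma levelExcess_middle {m : ℕ} (hm : 1 ≤ m) :
    levelExcess (m.choose (m / 2)) m = (m - 1 : ℝ) - ((2 : ℝ) ^ m - 2) / (m.choose (m / 2) : ℝ) := by
  have hl : (0 : ℝ) < (m.choose (m / 2) : ℕ) := by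
    exact_mod_cast Nat.choose_pos (Nat.div_le_self _ _)
  have h : ∀ i ∈ Finset.range (m - 1), max 0 (1 - (m.choose (i + 1) : ℝ) / (m.choose (m / 2) : ℕ))
      = 1 - (m.choose (i + 1) : ℝ) / (m.choose (m / 2) : ℕ) := by
    intro i _
    rw [max_eq_right]
    rw [sub_nonneg, div_le_one hl]
    exact_mod_cast Nat.choose_le_middle _ _
  rw [levelExcess, Finset.sum_congr rfl h, Finset.sum_sub_distrib, ← Finset.sum_div]
  have h2 : ((∑ i ∈ Finset.range (m - 1), m.choose (i + 1) : ℕ) : ℝ) + 2 = 2 ^ m := by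
    exact_mod_cast Nat.sum_range_choose_interior hm
  push_cast at h2
  rw [← h2]
  simp [Nat.cast_sub hm]

/-! ### Weights of sets in a single interval, and tight intervals. -/

section Interval

open Finset

variable {α : Type*} [DecidableEq α]

lemma sum_Icc_rank {A B : Finset α} (hAB : A ⊆ B) (φ : ℕ → ℝ) :
    ∑ D ∈ Icc A B, φ (#D - #A) = ∑ i ∈ range (#B - #A + 1), ((#B - #A).choose i : ℝ) * φ i := by
  have hinj : Set.InjOn (fun E => A ∪ E) ((B \ A).powerset : Set (Finset α)) := by
    intro E hE E' hE' h
    have hd : ∀ E ∈ ((B \ A).powerset : Set (Finset α)), (A ∪ E) \ A = E := by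
      intro E hE
      exact union_sdiff_cancel_left
        (disjoint_of_subset_right (mem_powerset.1 (mem_coe.1 hE)) disjoint_sdiff)
    rw [← hd E hE, ← hd E' hE']
    exact congrArg (· \ A) h
  rw [Icc_eq_image_powerset hAB, sum_image hinj, ← card_sdiff_of_subset hAB]
  have : ∀ E ∈ (B \ A).powerset, φ (#(A ∪ E) - #A) = φ #E := by
    intro E hE
    rw [card_union_of_disjoint
      (disjoint_of_subset_right (mem_powerset.1 hE) disjoint_sdiff), Nat.add_sub_cancel_left]
  rw [sum_congr rfl this, sum_powerset_apply_card φ]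
  simp

lemma sum_Ioo_rank {A B : Finset α} (hAB : A ⊂ B) (φ : ℕ → ℝ) :
    ∑ D ∈ Ioo A B, φ (#D - #A)
      = ∑ i ∈ range (#B - #A - 1), ((#B - #A).choose (i + 1) : ℝ) * φ (i + 1) := by
  have h := sum_Icc_rank hAB.1 φ
  have hlt := card_lt_card hAB
  rw [← Ioc_insert_left hAB.1, sum_insert (by simp), ← Ioo_insert_right hAB,
    sum_insert (by simp)] at h
  obtain ⟨e, he⟩ : ∃ e, #B - #A = e + 1 := ⟨#B - #A - 1, by omega⟩
  rw [he, sum_range_succ, sum_range_succ'] at h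
  rw [he]
  simp only [Nat.sub_self, Nat.choose_zero_right, Nat.cast_one, one_mul, Nat.choose_self] at h
  simp only [Nat.add_sub_cancel]
  linarith

/-- The weight of `D` in the Lubell function of the interval between `A` and `B`. -/
noncomputable def rankWeight (A B D : Finset α) : ℝ := 1 / ((#B - #A).choose (#D - #A) : ℝ)

/-- Linear programming duality with price `1 / l` per set: a weight is at most `1 / l` plus its
positive excess, and the excesses over the whole open interval add up, level by level, to
`levelExcess`. -/
lemma rankWeight_sum_le {A B : Finset α} (hAB : A ⊂ B) {X : Finset (Finset α)}
    (hX : X ⊆ Ioo A B) {l : ℝ} :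
    ∑ D ∈ X, rankWeight A B D ≤ levelExcess l (#B - #A) + #X / l := by
  have h1 : ∑ D ∈ X, (rankWeight A B D - 1 / l) ≤ levelExcess l (#B - #A) := by
    calc ∑ D ∈ X, (rankWeight A B D - 1 / l)
        ≤ ∑ D ∈ X, max 0 (rankWeight A B D - 1 / l) :=
          sum_le_sum fun _ _ => le_max_right _ _
      _ ≤ ∑ D ∈ Ioo A B, max 0 (rankWeight A B D - 1 / l) :=
          sum_le_sum_of_subset_of_nonneg hX fun _ _ _ => le_max_left _ _
      _ = levelExcess l (#B - #A) := by
          unfold rankWeight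
          rw [sum_Ioo_rank hAB (fun i => max 0 (1 / ((#B - #A).choose i : ℝ) - 1 / l)),
            levelExcess]
          refine sum_congr rfl fun i hi => ?_
          rw [mem_range] at hi
          have hp : (0 : ℝ) < ((#B - #A).choose (i + 1) : ℝ) := by
            exact_mod_cast Nat.choose_pos (by omega)
          rw [mul_max_of_nonneg _ _ hp.le, mul_zero, mul_sub, mul_one_div_cancel hp.ne',
            mul_one_div]
  rw [sum_sub_distrib, sum_const, nsmul_eq_mul, mul_one_div] at h1
  linarith

lemma rankWeight_sum_Ioo {A B : Finset α} (hAB : A ⊂ B) :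
    ∑ D ∈ Ioo A B, rankWeight A B D = ((#B - #A : ℕ) : ℝ) - 1 := by
  have hlt := card_lt_card hAB
  unfold rankWeight
  rw [sum_Ioo_rank hAB (fun i => 1 / ((#B - #A).choose i : ℝ))]
  have : ∀ i ∈ range (#B - #A - 1), ((#B - #A).choose (i + 1) : ℝ)
      * (1 / ((#B - #A).choose (i + 1) : ℝ)) = 1 := by
    intro i hi
    rw [mem_range] at hi
    have hp : (0 : ℝ) < ((#B - #A).choose (i + 1) : ℝ) := by
      exact_mod_cast Nat.choose_pos (by omega)
    exact mul_one_div_cancel hp.ne'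
  rw [sum_congr rfl this, sum_const, card_range, nsmul_eq_mul, mul_one,
    Nat.cast_sub (by omega), Nat.cast_one]

lemma card_Ioo_add_two {A B : Finset α} (hAB : A ⊂ B) : #(Ioo A B) + 2 = 2 ^ (#B - #A) := by
  have hlt := card_lt_card hAB
  have h := sum_Ioo_rank hAB (fun _ => 1)
  have h2 := Nat.sum_range_choose_interior (m := #B - #A) (by omega)
  simp only [sum_const, nsmul_eq_mul, mul_one] at h
  rw [← h2, add_left_inj]
  exact_mod_cast h

/-- The interval between `A` and `B` has rank `m` and misses exactly `h` members of `H`, all of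
them in a middle level. -/
def IsTight (H : Finset (Finset α)) (m h : ℕ) (A B : Finset α) : Prop :=
  #B = #A + m ∧ #(Ioo A B \ H) = h ∧
    ∀ D ∈ Ioo A B \ H, m.choose (#D - #A) = m.choose (m / 2)

lemma rankWeight_sum_rank_eq {H : Finset (Finset α)} {A B : Finset α} (hAB : A ⊂ B) :
    ∑ D ∈ Ioo A B ∩ H, rankWeight A B D
      = ((#B - #A : ℕ) : ℝ) - 1 - ∑ D ∈ Ioo A B \ H, rankWeight A B D := by
  rw [← rankWeight_sum_Ioo hAB, ← sum_inter_add_sum_sdiff (Ioo A B) H]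
  ring

lemma inv_middle_le_rankWeight {A B D : Finset α} (hD : D ∈ Ioo A B) {m : ℕ} (hm : #B - #A = m) :
    1 / (m.choose (m / 2) : ℝ) ≤ rankWeight A B D := by
  rw [mem_Ioo] at hD
  have h1 := card_lt_card hD.1
  have h2 := card_lt_card hD.2
  unfold rankWeight
  rw [hm]
  refine one_div_le_one_div_of_le ?_ ?_
  · exact_mod_cast Nat.choose_pos (by omega)
  · exact_mod_cast Nat.choose_le_middle _ _

/-- Every missing set costs at least `1 / M`, with `M` the middle coefficient. If the interval is
not tight, either an extra set is missing, costing another `1 / M`, or some missing set is off the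
middle and costs at least `1 / (M - 1)`. Both exceed the claimed gain. -/
lemma rankWeight_sum_le_of_not_isTight {H : Finset (Finset α)} {m h : ℕ} {A B : Finset α}
    (hAB : A ⊂ B) (hm : #B = #A + m) (hcard : #(Ioo A B ∩ H) + h + 2 ≤ 2 ^ m)
    (ht : ¬ IsTight H m h A B) :
    ∑ D ∈ Ioo A B ∩ H, rankWeight A B D
      ≤ m - 1 - h / (m.choose (m / 2) : ℝ)
        - 1 / ((m.choose (m / 2) : ℝ) * (m.choose (m / 2) + 1)) := by
  have hd : #B - #A = m := by omega
  have h0 := card_Ioo_add_two hAB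
  have h1 := card_sdiff_add_card_inter (Ioo A B) H
  rw [hd] at h0
  have hmiss : h ≤ #(Ioo A B \ H) := by omega
  rw [rankWeight_sum_rank_eq hAB, hd]
  set M : ℝ := (m.choose (m / 2) : ℝ) with hM
  have hM1 : 1 ≤ M := by
    rw [hM]; exact_mod_cast Nat.choose_pos (Nat.div_le_self _ _)
  have hM0 : 0 < M := by linarith
  have hsmall : 1 / (M * (M + 1)) ≤ 1 / M := by
    refine one_div_le_one_div_of_le hM0 ?_
    nlinarith
  have hmem : ∀ D ∈ Ioo A B \ H, 1 / M ≤ rankWeight A B D := fun D hD =>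
    inv_middle_le_rankWeight (mem_sdiff.1 hD).1 hd
  suffices h / M + 1 / (M * (M + 1)) ≤ ∑ D ∈ Ioo A B \ H, rankWeight A B D by linarith
  rcases hmiss.lt_or_eq with hlt | heq
  · have h2 := card_nsmul_le_sum _ _ _ hmem
    rw [nsmul_eq_mul, mul_one_div] at h2
    have h3 : ((h : ℝ) + 1) / M ≤ (#(Ioo A B \ H) : ℝ) / M := by
      gcongr
      exact_mod_cast hlt
    rw [add_div] at h3
    linarith
  · have : ∃ D ∈ Ioo A B \ H, m.choose (#D - #A) ≠ m.choose (m / 2) := by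
      by_contra hcon
      push Not at hcon
      exact ht ⟨hm, heq.symm, hcon⟩
    obtain ⟨D, hD, hne⟩ := this
    have h2 := card_nsmul_le_sum ((Ioo A B \ H).erase D) (rankWeight A B) (1 / M)
      fun D' hD' => hmem D' (mem_of_mem_erase hD')
    rw [nsmul_eq_mul, mul_one_div, card_erase_of_mem hD, ← heq] at h2
    have hpos : 1 ≤ h := by
      rw [heq]; exact card_pos.2 ⟨D, hD⟩
    rw [Nat.cast_sub hpos, Nat.cast_one, sub_div] at h2
    have h3 : 1 / M + 1 / (M * (M + 1)) ≤ rankWeight A B D := by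
      have hlt : m.choose (#D - #A) + 1 ≤ m.choose (m / 2) :=
        lt_of_le_of_ne (Nat.choose_le_middle _ _) hne
      have hlt' : (m.choose (#D - #A) : ℝ) + 1 ≤ M := by rw [hM]; exact_mod_cast hlt
      have hp : (0 : ℝ) < (m.choose (#D - #A) : ℝ) := by
        have hD' := mem_Ioo.1 (mem_sdiff.1 hD).1
        have := card_lt_card hD'.2
        exact_mod_cast Nat.choose_pos (by omega)
      unfold rankWeight
      rw [hd, div_add_div _ _ hM0.ne' (by positivity), div_le_div_iff₀ (by positivity) hp]
      nlinarith [mul_pos hM0 hM0]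
    rw [← sum_erase_add _ _ hD]
    linarith

end Interval

/-! ### Bounds for the Lubell function on an interval of any rank. -/

section IntervalBounds

open Finset

variable {α : Type*} [DecidableEq α]

lemma lubell_self {H : Finset (Finset α)} {A : Finset α} (hA : A ∈ H) : lubell H A A = 1 := by
  have : (H.filter fun D => A ⊆ D ∧ D ⊆ A) = {A} := by
    ext D
    simp only [mem_filter, mem_singleton]
    constructor
    · rintro ⟨-, h1, h2⟩; exact subset_antisymm h2 h1
    · rintro rfl; exact ⟨hA, subset_rfl, subset_rfl⟩
  simp [lubell, this]

lemma lubell_eq_two_add {H : Finset (Finset α)} {A B : Finset α} (hA : A ∈ H) (hB : B ∈ H)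
    (hAB : A ⊂ B) : lubell H A B = 2 + ∑ D ∈ Ioo A B ∩ H, rankWeight A B D := by
  have : (H.filter fun D => A ⊆ D ∧ D ⊆ B) = insert A (insert B (Ioo A B ∩ H)) := by
    ext D
    simp only [mem_filter, mem_insert, mem_inter, mem_Ioo]
    constructor
    · rintro ⟨h, h1, h2⟩
      rcases eq_or_ssubset_of_subset h1 with h3 | h3
      · exact Or.inl h3.symm
      rcases eq_or_ssubset_of_subset h2 with h4 | h4
      · exact Or.inr (Or.inl h4)
      · exact Or.inr (Or.inr ⟨⟨h3, h4⟩, h⟩)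
    · rintro (rfl | rfl | ⟨⟨h1, h2⟩, h3⟩)
      · exact ⟨hA, subset_rfl, hAB.1⟩
      · exact ⟨hB, hAB.1, subset_rfl⟩
      · exact ⟨h3, h1.1, h2.1⟩
  rw [lubell, this, sum_insert (by simp [hAB.ne]), sum_insert (by simp)]
  simp only [Nat.sub_self, Nat.choose_zero_right, Nat.choose_self, Nat.cast_one, div_one]
  rw [← add_assoc]
  norm_num [rankWeight]

lemma lubell_le_rank_add_one {H : Finset (Finset α)} {A B : Finset α} (hA : A ∈ H) (hB : B ∈ H)
    (hAB : A ⊆ B) : lubell H A B ≤ ((#B - #A : ℕ) : ℝ) + 1 := by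
  rcases eq_or_ssubset_of_subset hAB with rfl | h
  · simp [lubell_self hA]
  · have h1 : ∑ D ∈ Ioo A B ∩ H, rankWeight A B D ≤ ∑ D ∈ Ioo A B, rankWeight A B D :=
      sum_le_sum_of_subset_of_nonneg inter_subset_left fun D _ _ => by
        unfold rankWeight; positivity
    rw [rankWeight_sum_Ioo h] at h1
    rw [lubell_eq_two_add hA hB h]
    linarith

lemma Nat.two_le_choose_middle {m : ℕ} (hm : 2 ≤ m) : 2 ≤ m.choose (m / 2) :=
  hm.trans (Nat.le_choose_of_pos_of_lt (by omega) (by omega))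

/-- With the middle coefficient of order `m` as `l`, the excess does not increase with the rank from
`m` on, so the worst case is rank `m`, where it is given by `levelExcess_middle`. -/
lemma lubell_le_of_le_rank {H : Finset (Finset α)} {m h : ℕ} (hm : 2 ≤ m) {A B : Finset α}
    (hA : A ∈ H) (hB : B ∈ H) (hAB : A ⊆ B) (hd : m ≤ #B - #A)
    (hcard : #(Ioo A B ∩ H) + h + 2 ≤ 2 ^ m) :
    lubell H A B ≤ m + 1 - h / (m.choose (m / 2) : ℝ) := by
  have hAB' : A ⊂ B := ssubset_of_subset_of_ne hAB (by rintro rfl; omega)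
  have hM : (0 : ℝ) < (m.choose (m / 2) : ℝ) := by
    exact_mod_cast Nat.choose_pos (Nat.div_le_self _ _)
  have h1 := rankWeight_sum_le hAB' (inter_subset_left (s₂ := H)) (l := (m.choose (m / 2) : ℝ))
  have h2 := levelExcess_le_of_le (by omega) hd hM le_rfl
  rw [levelExcess_middle (by omega)] at h2
  have hc : (#(Ioo A B ∩ H) : ℝ) ≤ 2 ^ m - 2 - h := by
    have : (#(Ioo A B ∩ H) : ℝ) + h + 2 ≤ 2 ^ m := by exact_mod_cast hcard
    linarith
  have h3 := div_le_div_of_nonneg_right hc hM.le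
  rw [sub_div] at h3
  rw [lubell_eq_two_add hA hB hAB']
  linarith

lemma lubell_le_max {H : Finset (Finset α)} {m h : ℕ} (hm : 2 ≤ m)
    (hcard : ∀ A ∈ H, ∀ B ∈ H, A ⊂ B → #(Ioo A B ∩ H) + h + 2 ≤ 2 ^ m) {A B : Finset α}
    (hA : A ∈ H) (hB : B ∈ H) (hAB : A ⊆ B) :
    lubell H A B ≤ max (m : ℝ) (m + 1 - h / (m.choose (m / 2) : ℝ)) := by
  rcases lt_or_ge (#B - #A) m with hd | hd
  · refine ((lubell_le_rank_add_one hA hB hAB).trans ?_).trans (le_max_left _ _)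
    exact_mod_cast hd
  · have hAB' : A ⊂ B := ssubset_of_subset_of_ne hAB (by rintro rfl; omega)
    exact (lubell_le_of_le_rank hm hA hB hAB hd (hcard A hA B hB hAB')).trans (le_max_right _ _)

/-- For `m ≥ 4` the strict drop of the excess from rank `m` to `m + 1` gives the gain. For `m = 2,
3` there is no such drop, but all interior weights are at most `1 / (m + 1)`, which is small enough
directly. -/
lemma lubell_le_of_lt_rank {H : Finset (Finset α)} {m h : ℕ} (hm : 2 ≤ m)
    (hh : h < m.choose (m / 2)) {A B : Finset α} (hA : A ∈ H) (hB : B ∈ H) (hAB : A ⊆ B)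
    (hd : m < #B - #A) (hcard : #(Ioo A B ∩ H) + h + 2 ≤ 2 ^ m) :
    lubell H A B ≤ m + 1 - h / (m.choose (m / 2) : ℝ)
      - 1 / ((m.choose (m / 2) : ℝ) * (m.choose (m / 2) + 1)) := by
  have hAB' : A ⊂ B := ssubset_of_subset_of_ne hAB (by rintro rfl; omega)
  have hM : (0 : ℝ) < (m.choose (m / 2) : ℝ) := by
    exact_mod_cast Nat.choose_pos (Nat.div_le_self _ _)
  have hc : (#(Ioo A B ∩ H) : ℝ) ≤ 2 ^ m - 2 - h := by
    have : (#(Ioo A B ∩ H) : ℝ) + h + 2 ≤ 2 ^ m := by exact_mod_cast hcard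
    linarith
  rw [lubell_eq_two_add hA hB hAB']
  rcases lt_or_ge m 4 with h4 | h4
  · have hMm : m.choose (m / 2) = m ∧ (2 : ℝ) ^ m - 2 = m * (m - 1) ∧ h + 3 ≤ 2 ^ m := by
      interval_cases m
      · norm_num at hh ⊢; omega
      · norm_num [Nat.choose] at hh ⊢; omega
    obtain ⟨hMm, hpow, hh3⟩ := hMm
    rw [hMm]
    have hm0 : (0 : ℝ) < m := by positivity
    have hw : ∀ D ∈ Ioo A B ∩ H, rankWeight A B D ≤ 1 / ((m : ℝ) + 1) := by
      intro D hD
      have hD' := mem_Ioo.1 (mem_inter.1 hD).1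
      have h1 := card_lt_card hD'.1
      have h2 := card_lt_card hD'.2
      refine one_div_le_one_div_of_le (by positivity) ?_
      have := Nat.le_choose_of_pos_of_lt (n := #B - #A) (k := #D - #A) (by omega) (by omega)
      exact_mod_cast (Nat.succ_le_of_lt hd).trans this
    have h1 := sum_le_card_nsmul _ _ _ hw
    rw [nsmul_eq_mul, mul_one_div] at h1
    have h2 : (#(Ioo A B ∩ H) : ℝ) / (m + 1) ≤ (m * (m - 1) - h) / (m + 1) := by
      gcongr
      rw [← hpow]; exact hc
    have hh3' : (h : ℝ) + 1 ≤ m * (m - 1) := by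
      have : (h : ℝ) + 3 ≤ 2 ^ m := by exact_mod_cast hh3
      linarith
    -- After clearing denominators this is `h + 1 ≤ m * (m - 1)`, with equality for `m = 2`, `h =
    -- 1`: this case dictates the factor `M + 1` in the gain.
    have h3 : ((m : ℝ) * (m - 1) - h) / (m + 1)
        ≤ m - 1 - h / m - 1 / (m * (m + 1)) := by
      have : (m : ℝ) - 1 - h / m - 1 / (m * (m + 1))
          = ((m - 1) * (m * (m + 1)) - h * (m + 1) - 1) / (m * (m + 1)) := by
        field_simp
      rw [this, div_le_div_iff₀ (by positivity) (by positivity)]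
      have : 0 ≤ ((m : ℝ) + 1) * (m * (m - 1) - h - 1) :=
        mul_nonneg (by positivity) (by linarith)
      nlinarith
    linarith
  · have h1 := rankWeight_sum_le hAB' (inter_subset_left (s₂ := H)) (l := (m.choose (m / 2) : ℝ))
    have h2 := levelExcess_le_of_le (by omega) (Nat.succ_le_of_lt hd) hM
      (by exact_mod_cast Nat.choose_middle_mono (Nat.le_succ m))
    have h2' := levelExcess_succ_le_sub h4
    rw [levelExcess_middle (by omega)] at h2'
    have h3 := div_le_div_of_nonneg_right hc hM.le
    rw [sub_div] at h3
    have h4 : 1 / ((m.choose (m / 2) : ℝ) * (m.choose (m / 2) + 1))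
        ≤ 1 / (m.choose (m / 2) : ℝ) := by
      refine one_div_le_one_div_of_le hM ?_
      nlinarith
    linarith

/-- Smaller rank gives at most `m` levels, and `h + 1 ≤ M` turns the distance from `m` to the bound
into at least `1 / M`; rank `m` and larger ranks are the two preceding cases. -/
lemma lubell_le_of_not_isTight {H : Finset (Finset α)} {m h : ℕ} (hm : 2 ≤ m)
    (hh : h < m.choose (m / 2))
    (hcard : ∀ A ∈ H, ∀ B ∈ H, A ⊂ B → #(Ioo A B ∩ H) + h + 2 ≤ 2 ^ m) {A B : Finset α}
    (hA : A ∈ H) (hB : B ∈ H) (hAB : A ⊆ B) (ht : ¬ IsTight H m h A B) :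
    lubell H A B ≤ m + 1 - h / (m.choose (m / 2) : ℝ)
      - 1 / ((m.choose (m / 2) : ℝ) * (m.choose (m / 2) + 1)) := by
  have hM : (0 : ℝ) < (m.choose (m / 2) : ℝ) := by
    exact_mod_cast Nat.choose_pos (Nat.div_le_self _ _)
  have hcle := card_le_card hAB
  rcases lt_trichotomy (#B - #A) m with hd | hd | hd
  · have h1 : lubell H A B ≤ m := by
      refine (lubell_le_rank_add_one hA hB hAB).trans ?_
      exact_mod_cast hd
    have h2 : ((h : ℝ) + 1) / (m.choose (m / 2) : ℝ) ≤ 1 := by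
      rw [div_le_one hM]
      exact_mod_cast hh
    rw [add_div] at h2
    have h4 : 1 / ((m.choose (m / 2) : ℝ) * (m.choose (m / 2) + 1))
        ≤ 1 / (m.choose (m / 2) : ℝ) := by
      refine one_div_le_one_div_of_le hM ?_
      nlinarith
    linarith
  · have hAB' : A ⊂ B := ssubset_of_subset_of_ne hAB (by rintro rfl; omega)
    have := rankWeight_sum_le_of_not_isTight hAB' (by omega) (hcard A hA B hB hAB') ht
    rw [lubell_eq_two_add hA hB hAB']
    linarith
  · have hAB' : A ⊂ B := ssubset_of_subset_of_ne hAB (by rintro rfl; omega)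
    exact lubell_le_of_lt_rank hm hh hA hB hAB hd (hcard A hA B hB hAB')

lemma lubell_le_of_lt {H : Finset (Finset α)} {m h : ℕ} (hm : 2 ≤ m)
    (hh : h < m.choose (m / 2))
    (hcard : ∀ A ∈ H, ∀ B ∈ H, A ⊂ B → #(Ioo A B ∩ H) + h + 2 ≤ 2 ^ m) {A B : Finset α}
    (hA : A ∈ H) (hB : B ∈ H) (hAB : A ⊆ B) :
    lubell H A B ≤ m + 1 - h / (m.choose (m / 2) : ℝ) := by
  refine (lubell_le_max hm hcard hA hB hAB).trans (max_le ?_ le_rfl)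
  have hM : (0 : ℝ) < (m.choose (m / 2) : ℝ) := by exact_mod_cast (Nat.zero_le _).trans_lt hh
  have : (h : ℝ) / (m.choose (m / 2) : ℝ) ≤ 1 := by
    rw [div_le_one hM]
    exact_mod_cast hh.le
  linarith

end IntervalBounds

/-! ### Injectivity of inclusion matrices, and irregularity inside `m`-sets. -/

section Inclusion

open Finset

variable {α : Type*} [DecidableEq α]

lemma sum_powersetCard_erase (w : Finset α → ℝ) (u : ℕ) (U : Finset α) :
    ∑ a ∈ U, ∑ E ∈ powersetCard u (U.erase a), w E
      = ((#U : ℝ) - u) * ∑ E ∈ powersetCard u U, w E := by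
  have h1 : ∀ a ∈ U, ∑ E ∈ powersetCard u (U.erase a), w E
      = ∑ E ∈ powersetCard u U, if a ∉ E then w E else 0 := by
    intro a _
    rw [← sum_filter]
    refine sum_congr ?_ fun _ _ => rfl
    ext E
    simp only [mem_powersetCard, mem_filter, subset_erase]
    tauto
  rw [sum_congr rfl h1, sum_comm, mul_sum]
  refine sum_congr rfl fun E hE => ?_
  rw [mem_powersetCard] at hE
  rw [← sum_filter, sum_const, nsmul_eq_mul, filter_notMem_eq_sdiff, card_sdiff_of_subset hE.1,
    Nat.cast_sub (card_le_card hE.1), hE.2]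

/-- The inclusion matrix between the `u`-subsets and the `m`-subsets of a set with at least
`m + u` elements is injective. -/
lemma eq_zero_of_sum_powersetCard_eq_zero {S : Finset α} {w : Finset α → ℝ} {u m : ℕ}
    (hum : u ≤ m) (hS : m + u ≤ #S)
    (h : ∀ T ⊆ S, #T = m → ∑ E ∈ powersetCard u T, w E = 0) {E : Finset α} (hES : E ⊆ S)
    (hE : #E = u) : w E = 0 := by
  -- The vanishing passes from `j`-sets to `(j + 1)`-sets by averaging over the deletion of one
  -- element.
  have h1 : ∀ j, m ≤ j → ∀ U ⊆ S, #U = j → ∑ E ∈ powersetCard u U, w E = 0 := by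
    intro j hj
    induction j, hj using Nat.le_induction with
    | base => exact h
    | succ j hj ih =>
      intro U hU hc
      have h2 := sum_powersetCard_erase w u U
      rw [sum_eq_zero fun a ha => ih (U.erase a) ((erase_subset _ _).trans hU)
        (by rw [card_erase_of_mem ha, hc, Nat.add_sub_cancel])] at h2
      have h3 : ((#U : ℝ) - u) ≠ 0 := by
        rw [hc, sub_ne_zero]
        exact_mod_cast (by omega : j + 1 ≠ u)
      exact (mul_eq_zero.1 h2.symm).resolve_left h3
  -- Sets containing `insert a Z` are those containing `Z` minus those that also avoid `a`, and the
  -- latter live in `U.erase a`. Each element of `Z` thus costs one element of `U`; the case where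
  -- `Z` is the `u`-set itself isolates a single weight.
  have h2 : ∀ Z U : Finset α, U ⊆ S → Z ⊆ U → m + #Z ≤ #U →
      ∑ E ∈ (powersetCard u U).filter fun E => Z ⊆ E, w E = 0 := by
    intro Z
    induction Z using Finset.induction_on with
    | empty =>
      intro U hU _ hc
      simpa using h1 _ (by simpa using hc) U hU rfl
    | insert a Z ha ih =>
      intro U hU hZU hc
      rw [card_insert_of_notMem ha] at hc
      have haU : a ∈ U := hZU (mem_insert_self _ _)
      have h3 := ih U hU ((subset_insert _ _).trans hZU) (by omega)
      have h4 := ih (U.erase a) ((erase_subset _ _).trans hU)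
        (subset_erase.2 ⟨(subset_insert _ _).trans hZU, ha⟩)
        (by rw [card_erase_of_mem haU]; omega)
      rw [← sum_filter_add_sum_filter_not _ (fun E => a ∈ E), filter_filter, filter_filter] at h3
      have h5 : ((powersetCard u U).filter fun E => Z ⊆ E ∧ a ∉ E)
          = (powersetCard u (U.erase a)).filter fun E => Z ⊆ E := by
        ext E
        simp only [mem_powersetCard, mem_filter, subset_erase]
        tauto
      rw [h5, h4, add_zero] at h3
      rw [← h3]
      refine sum_congr ?_ fun _ _ => rfl
      ext E
      simp only [mem_filter, insert_subset_iff]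
      tauto
  have h3 := h2 E S subset_rfl hES (by omega)
  have h4 : ((powersetCard u S).filter fun E' => E ⊆ E') = {E} := by
    ext E'
    simp only [mem_powersetCard, mem_filter, mem_singleton]
    constructor
    · rintro ⟨⟨_, h5⟩, h6⟩
      exact (eq_of_subset_of_card_le h6 (by omega)).symm
    · rintro rfl
      exact ⟨⟨hES, hE⟩, subset_rfl⟩
  rwa [h4, sum_singleton] at h3

lemma eq_div_choose_of_sum_powersetCard_eq {S : Finset α} {w : Finset α → ℝ} {u m : ℕ} {c : ℝ}
    (hum : u ≤ m) (hS : m + u ≤ #S)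
    (h : ∀ T ⊆ S, #T = m → ∑ E ∈ powersetCard u T, w E = c) {E : Finset α} (hES : E ⊆ S)
    (hE : #E = u) : w E = c / m.choose u := by
  have hp : ((m.choose u : ℕ) : ℝ) ≠ 0 := by exact_mod_cast (Nat.choose_pos hum).ne'
  have := eq_zero_of_sum_powersetCard_eq_zero (w := fun E => w E - c / m.choose u) hum hS
    (fun T hT hc => by
      rw [sum_sub_distrib, h T hT hc, sum_const, card_powersetCard, hc, nsmul_eq_mul,
        mul_div_cancel₀ _ hp, sub_self]) hES hE
  linarith

/-- Each `l`-subset of `T` lies in exactly `#T - l` subsets of `T` of size `l + 1`. -/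
lemma sum_powersetCard_succ_sum (x : Finset α → ℝ) (l : ℕ) (T : Finset α) :
    ∑ E' ∈ powersetCard (l + 1) T, ∑ E ∈ powersetCard l E', x E
      = ((#T : ℝ) - l) * ∑ E ∈ powersetCard l T, x E := by
  have h1 : ∀ E' ∈ powersetCard (l + 1) T, ∑ E ∈ powersetCard l E', x E
      = ∑ E ∈ powersetCard l T, if E ⊆ E' then x E else 0 := by
    intro E' hE'
    rw [mem_powersetCard] at hE'
    rw [← sum_filter]
    refine sum_congr ?_ fun _ _ => rfl
    ext E
    simp only [mem_powersetCard, mem_filter]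
    constructor
    · rintro ⟨h1, h2⟩; exact ⟨⟨h1.trans hE'.1, h2⟩, h1⟩
    · rintro ⟨⟨_, h2⟩, h1⟩; exact ⟨h1, h2⟩
  rw [sum_congr rfl h1, sum_comm, mul_sum]
  refine sum_congr rfl fun E hE => ?_
  rw [mem_powersetCard] at hE
  have h2 : ((powersetCard (l + 1) T).filter fun E' => E ⊆ E')
      = (T \ E).image fun a => insert a E := by
    ext E'
    simp only [mem_powersetCard, mem_filter, mem_image, Finset.mem_sdiff]
    constructor
    · rintro ⟨⟨h1, h2⟩, h3⟩
      obtain ⟨a, ha⟩ := card_eq_one.1 (show #(E' \ E) = 1 by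
        rw [card_sdiff_of_subset h3]; omega)
      have ha' : a ∈ E' \ E := by rw [ha]; exact mem_singleton_self a
      rw [Finset.mem_sdiff] at ha'
      refine ⟨a, ⟨h1 ha'.1, ha'.2⟩, ?_⟩
      rw [insert_eq, ← ha, sdiff_union_of_subset h3]
    · rintro ⟨a, ⟨h1, h2⟩, rfl⟩
      exact ⟨⟨insert_subset h1 hE.1, by rw [card_insert_of_notMem h2, hE.2]⟩, subset_insert _ _⟩
  rw [← sum_filter, sum_const, nsmul_eq_mul, h2, card_image_of_injOn, card_sdiff_of_subset hE.1,
    Nat.cast_sub (card_le_card hE.1), hE.2]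
  intro a ha b hb hab
  rw [mem_coe, Finset.mem_sdiff] at ha hb
  have : a ∈ insert b E := by
    rw [← show insert a E = insert b E from hab]; exact mem_insert_self _ _
  exact (mem_insert.1 this).resolve_right ha.2

lemma Nat.choose_lt_choose_middle {m k : ℕ} (hk : k < m / 2) :
    m.choose k < m.choose (m / 2) := by
  refine lt_of_lt_of_le ?_ (Nat.choose_le_middle (k + 1) m)
  have h1 := Nat.choose_succ_right_eq m k
  have h2 : 0 < m.choose k := Nat.choose_pos (by omega)
  have h3 : k + 1 < m - k := by omega
  by_contra hcon
  push Not at hcon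
  have h4 : m.choose (k + 1) * (k + 1) ≤ m.choose k * (k + 1) := Nat.mul_le_mul_right _ hcon
  have h5 : m.choose k * (k + 1) < m.choose k * (m - k) := Nat.mul_lt_mul_of_pos_left h3 h2
  omega

lemma Nat.eq_middle_of_choose_eq {m k : ℕ} (hk : k ≤ m) (h : m.choose k = m.choose (m / 2)) :
    k = m / 2 ∨ k = m - m / 2 := by
  by_contra hcon
  push Not at hcon
  rcases lt_or_gt_of_ne hcon.1 with h1 | h1
  · exact (Nat.choose_lt_choose_middle h1).ne h
  · have h2 : m - k < m / 2 := by omega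
    have h3 := Nat.choose_lt_choose_middle h2
    rw [Nat.choose_symm hk] at h3
    exact h3.ne h

/-- No property of subsets of a large set `S` holds, inside each `m`-subset of `S`, for the same
intermediate number of sets, all of them in a middle level. -/
lemma exists_not_middle_regular {m h : ℕ} (hm : 2 ≤ m) (h0 : 0 < h) (hh : h < m.choose (m / 2))
    {S : Finset α} (hS : 2 * m ≤ #S) (P : Finset α → Prop)
    [DecidablePred P] :
    ∃ T ⊆ S, #T = m ∧ ¬ (#(T.powerset.filter fun E => (E.Nonempty ∧ E ≠ T) ∧ P E) = h ∧
      ∀ E ∈ T.powerset.filter fun E => (E.Nonempty ∧ E ≠ T) ∧ P E,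
        m.choose #E = m.choose (m / 2)) := by
  by_contra hcon
  push Not at hcon
  have hM : (0 : ℝ) < (m.choose (m / 2) : ℝ) := by exact_mod_cast (Nat.zero_le _).trans_lt hh
  have h0' : (0 : ℝ) < h := by exact_mod_cast h0
  have hh' : (h : ℝ) / (m.choose (m / 2) : ℝ) < 1 := by
    rw [div_lt_one hM]; exact_mod_cast hh
  have hhpos : (0 : ℝ) < (h : ℝ) / (m.choose (m / 2) : ℝ) := by positivity
  set x : Finset α → ℝ := fun E => if P E then 1 else 0 with hx
  have hx01 : ∀ E, x E = 0 ∨ x E = 1 := fun E => by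
    simp only [hx]; split_ifs <;> simp
  have hcount : ∀ (u : ℕ) (T : Finset α), ∑ E ∈ powersetCard u T, x E
      = #((powersetCard u T).filter P) := fun u T => by
    simp only [hx]; rw [sum_boole]
  have hlevel : ∀ T ⊆ S, #T = m → ∀ E ⊆ T, E.Nonempty ∧ E ≠ T → P E →
      #E = m / 2 ∨ #E = m - m / 2 := by
    intro T hT hc E hE hne hP
    refine Nat.eq_middle_of_choose_eq (hc ▸ card_le_card hE) ((hcon T hT hc).2 E ?_)
    rw [mem_filter, mem_powerset]
    exact ⟨hE, hne, hP⟩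
  have hproper : ∀ T : Finset α, #T = m → ∀ E ⊆ T, 0 < #E → #E < m → E.Nonempty ∧ E ≠ T := by
    intro T hc E _ h1 h2
    exact ⟨card_pos.1 h1, by rintro rfl; omega⟩
  -- For `m = 2 * u` there is one middle level: the indicator `x` has sum `h` on the `u`-subsets of
  -- every `m`-set, so it is the constant `h / M`, strictly between 0 and 1.
  rcases Nat.even_or_odd' m with ⟨u, hu | hu⟩
  · obtain ⟨E, hES, hE⟩ := exists_subset_card_eq (show u ≤ #S by omega)
    have hsum : ∀ T ⊆ S, #T = m → ∑ E ∈ powersetCard u T, x E = h := by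
      intro T hT hc
      rw [hcount, ← (hcon T hT hc).1]
      congr 2
      ext E
      simp only [mem_filter, mem_powersetCard, mem_powerset]
      constructor
      · rintro ⟨⟨h1, h2⟩, h3⟩
        exact ⟨h1, hproper T hc E h1 (by omega) (by omega), h3⟩
      · rintro ⟨h1, h2, h3⟩
        have := hlevel T hT hc E h1 h2 h3
        exact ⟨⟨h1, by omega⟩, h3⟩
    have h1 := eq_div_choose_of_sum_powersetCard_eq (by omega) (by omega) hsum hES hE
    rw [show u = m / 2 by omega] at h1
    rcases hx01 E with h2 | h2 <;> linarith
  · have hl : m / 2 = u := by omega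
    rw [hl] at hh' hhpos
    -- For `m = 2 * u + 1` both middle levels are folded into one weight on `(u + 1)`-sets: inside
    -- an `m`-set every `u`-set has `u + 1` supersets of that size, so it is counted with the same
    -- factor `u + 1` as the upper level.
    have hsum : ∀ T ⊆ S, #T = m → ∑ E' ∈ powersetCard (u + 1) T,
        ((u + 1) * x E' + ∑ E ∈ powersetCard u E', x E) = (u + 1) * h := by
      intro T hT hc
      rw [sum_add_distrib, ← mul_sum, sum_powersetCard_succ_sum, hc, hu]
      push_cast
      rw [show (2 * (u : ℝ) + 1 - u) = u + 1 by ring, ← mul_add]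
      congr 1
      rw [hcount, hcount, ← (hcon T hT hc).1]
      rw [← Nat.cast_add, ← card_union_of_disjoint]
      · congr 2
        ext E
        simp only [mem_filter, mem_powersetCard, mem_powerset, mem_union]
        constructor
        · rintro (⟨⟨h1, h2⟩, h3⟩ | ⟨⟨h1, h2⟩, h3⟩)
          · exact ⟨h1, hproper T hc E h1 (by omega) (by omega), h3⟩
          · exact ⟨h1, hproper T hc E h1 (by omega) (by omega), h3⟩
        · rintro ⟨h1, h2, h3⟩
          have := hlevel T hT hc E h1 h2 h3
          rcases this with h4 | h4
          · exact Or.inr ⟨⟨h1, by omega⟩, h3⟩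
          · exact Or.inl ⟨⟨h1, by omega⟩, h3⟩
      · rw [disjoint_left]
        intro E h1 h2
        simp only [mem_filter, mem_powersetCard] at h1 h2
        omega
    have hchoose : m.choose (u + 1) = m.choose u := by
      rw [← Nat.choose_symm_of_eq_add (show m = u + 1 + u by omega)]
    have hw : ∀ E' ⊆ S, #E' = u + 1 → (u + 1) * x E' + ∑ E ∈ powersetCard u E', x E
        = (u + 1) * (h / (m.choose u : ℝ)) := by
      intro E' hE'S hE'
      have := eq_div_choose_of_sum_powersetCard_eq (by omega) (by omega) hsum hE'S hE'
      rw [this, hchoose, mul_div_assoc]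
    have hu1 : (0 : ℝ) < (u : ℝ) + 1 := by positivity
    -- The constant value of the weight is below `u + 1`, which forces `x E' = 0` on the upper
    -- level. Injectivity is then applied once more, to `u`-sets against `(u + 1)`-sets.
    have hfacets : ∀ E' ⊆ S, #E' = u + 1 → ∑ E ∈ powersetCard u E', x E
        = (u + 1) * (h / (m.choose u : ℝ)) := by
      intro E' hE'S hE'
      have h1 := hw E' hE'S hE'
      rcases hx01 E' with h2 | h2
      · rwa [h2, mul_zero, zero_add] at h1
      · exfalso
        have h3 : 0 ≤ ∑ E ∈ powersetCard u E', x E := sum_nonneg fun E _ => by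
          rcases hx01 E with h | h <;> rw [h]; exact zero_le_one
        rw [h2, mul_one] at h1
        nlinarith
    obtain ⟨E, hES, hE⟩ := exists_subset_card_eq (show u ≤ #S by omega)
    have h1 := eq_div_choose_of_sum_powersetCard_eq (by omega) (by omega) hfacets hES hE
    rw [Nat.choose_succ_self_right] at h1
    push_cast at h1
    rw [mul_div_cancel_left₀ _ hu1.ne'] at h1
    rcases hx01 E with h2 | h2 <;> linarith

end Inclusion

/-! ### A constant gain from intervals that are not tight. -/

section Strict

open Finset Numbering

variable {α : Type*} [DecidableEq α]

/-- If all rank `m` intervals from `A` inside `S` were tight, being missing from `H` would be a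
property of subsets of `S \ A` of the kind excluded by `exists_not_middle_regular`. -/
lemma exists_not_isTight {H : Finset (Finset α)} {m h : ℕ} (hm : 2 ≤ m) (h0 : 0 < h)
    (hh : h < m.choose (m / 2)) {A S : Finset α} (hAS : A ⊆ S) (hS : #A + 2 * m ≤ #S) :
    ∃ D, A ⊆ D ∧ D ⊆ S ∧ #D = #A + m ∧ ¬ IsTight H m h A D := by
  obtain ⟨T, hTS, hT, hbad⟩ := exists_not_middle_regular hm h0 hh (S := S \ A)
    (by rw [card_sdiff_of_subset hAS]; omega) (fun E => A ∪ E ∉ H)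
  have hdis : ∀ E ⊆ T, Disjoint A E := fun E hE =>
    disjoint_of_subset_right (hE.trans hTS) disjoint_sdiff
  have hcard : ∀ E ⊆ T, #(A ∪ E) = #A + #E := fun E hE => card_union_of_disjoint (hdis E hE)
  refine ⟨A ∪ T, subset_union_left, union_subset hAS (hTS.trans sdiff_subset),
    by rw [hcard T subset_rfl, hT], fun ht => hbad ?_⟩
  have himage : Ioo A (A ∪ T) \ H = (T.powerset.filter fun E => (E.Nonempty ∧ E ≠ T) ∧
      A ∪ E ∉ H).image fun E => A ∪ E := by
    ext D
    simp only [Finset.mem_sdiff, mem_Ioo, mem_image, mem_filter, mem_powerset]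
    constructor
    · rintro ⟨⟨h1, h2⟩, h3⟩
      have h4 : A ∪ D \ A = D := union_sdiff_of_subset h1.1
      refine ⟨D \ A, ⟨?_, ⟨?_, ?_⟩, ?_⟩, h4⟩
      · exact (sdiff_subset_sdiff h2.1 subset_rfl).trans
          (union_sdiff_cancel_left (hdis T subset_rfl)).subset
      · exact sdiff_nonempty.2 h1.2
      · intro h5
        rw [h5] at h4
        exact h2.ne h4.symm
      · rwa [h4]
    · rintro ⟨E, ⟨h1, ⟨h2, h3⟩, h4⟩, rfl⟩
      have h5 := hcard E h1
      have h6 := card_pos.2 h2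
      have h7 := card_lt_card (ssubset_of_subset_of_ne h1 h3)
      have h8 := hcard T subset_rfl
      refine ⟨⟨ssubset_of_subset_of_ne subset_union_left ?_,
        ssubset_of_subset_of_ne (union_subset_union_right h1) ?_⟩, h4⟩
      · intro h9
        rw [← h9] at h5
        omega
      · intro h9
        rw [h9] at h5
        omega
  have hinj : Set.InjOn (fun E => A ∪ E) ((T.powerset.filter fun E => (E.Nonempty ∧ E ≠ T) ∧
      A ∪ E ∉ H : Finset (Finset α)) : Set (Finset α)) := by
    intro E hE E' hE' heq
    rw [mem_coe, mem_filter, mem_powerset] at hE hE'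
    rw [← union_sdiff_cancel_left (hdis E hE.1), ← union_sdiff_cancel_left (hdis E' hE'.1)]
    exact congrArg (· \ A) heq
  obtain ⟨-, h1, h2⟩ := ht
  rw [himage] at h1 h2
  rw [card_image_of_injOn hinj] at h1
  refine ⟨h1, fun E hE => ?_⟩
  have h3 := h2 (A ∪ E) (mem_image_of_mem _ hE)
  rw [mem_filter, mem_powerset] at hE
  rwa [hcard E hE.1, Nat.add_sub_cancel_left] at h3

variable [Fintype α]

/-- Double counting of pairs `D ⊆ S` with `S` of rank `2 * m` above `A`: every `S` contains some `D`
that is not tight. Hence these make up at least a fraction `1 / (2 * m).choose m` of the sets of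
rank `m` above `A`. -/
lemma choose_le_card_not_isTight_mul {H : Finset (Finset α)} {m h : ℕ} (hm : 2 ≤ m) (h0 : 0 < h)
    (hh : h < m.choose (m / 2)) {A : Finset α} (hA : #A + 2 * m ≤ Fintype.card α)
    {N : Finset (Finset α)}
    (hN : ∀ D, A ⊆ D → #D = #A + m → ¬ IsTight H m h A D → D ∈ N)
    (hN' : ∀ D ∈ N, A ⊆ D ∧ #D = #A + m) :
    (Fintype.card α - #A).choose m ≤ #N * (2 * m).choose m := by
  set n := Fintype.card α with hn
  have h1 := card_mul_le_card_mul (fun S D : Finset α => D ⊆ S)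
    (s := univ.filter fun S => A ⊆ S ∧ S ⊆ univ ∧ #S = #A + 2 * m) (t := N) (m := 1)
    (n := (n - (#A + m)).choose m) ?_ ?_
  · rw [card_filter_between (subset_univ A) (by omega), card_univ, ← hn, mul_one,
      Nat.add_sub_cancel_left] at h1
    have h2 := Nat.choose_mul (n := n - #A) (show m ≤ 2 * m by omega)
    rw [show n - #A - m = n - (#A + m) by omega, show 2 * m - m = m by omega] at h2
    have h3 : 0 < (n - (#A + m)).choose m := Nat.choose_pos (by omega)
    refine Nat.le_of_mul_le_mul_right ?_ h3
    rw [← h2]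
    calc _ ≤ #N * (n - (#A + m)).choose m * (2 * m).choose m := Nat.mul_le_mul_right _ h1
      _ = _ := by ring
  · intro S hS
    simp only [mem_filter, mem_univ, true_and] at hS
    obtain ⟨D, hAD, hDS, hc, ht⟩ := exists_not_isTight (H := H) hm h0 hh hS.1 hS.2.2.ge
    exact card_pos.2 ⟨D, mem_filter.2 ⟨hN D hAD hc ht, hDS⟩⟩
  · intro D hD
    obtain ⟨hAD, hc⟩ := hN' D hD
    have h2 := card_filter_between (subset_univ D) (k := #A + 2 * m) (by omega)
    rw [card_univ, ← hn, hc, show #A + 2 * m - (#A + m) = m by omega] at h2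
    rw [← h2]
    refine card_le_card fun S hS => ?_
    rw [bipartiteBelow, mem_filter, mem_filter] at hS
    exact mem_filter.2 ⟨mem_univ _, hS.2, subset_univ _, hS.1.2.2.2⟩

/-- A chain with least member `A` passes through a uniformly distributed set of rank `m` above `A`.
If its greatest member closes a tight interval, that set is the greatest member, so the proportion
of tight sets bounds the probability. -/
lemma sum_card_block_isTight_le {H : Finset (Finset α)} {m h : ℕ} (hm : 2 ≤ m) (h0 : 0 < h)
    (hh : h < m.choose (m / 2)) {A : Finset α} (hA : #A + 2 * m ≤ Fintype.card α)
    {N : Finset (Finset α)} (hN : ∀ D ∈ N, D ∈ H ∧ A ⊆ D ∧ IsTight H m h A D) :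
    ∑ B ∈ N, (#(block H A B) : ℝ)
      ≤ (1 - 1 / ((2 * m).choose m : ℝ)) * #(block H A univ) := by
  set n := Fintype.card α with hn
  set U : Finset (Finset α) := univ.filter fun D => A ⊆ D ∧ D ⊆ univ ∧ #D = #A + m with hU
  have hUcard : #U = (n - #A).choose m := by
    rw [hU, card_filter_between (subset_univ A) (by omega), card_univ, ← hn,
      Nat.add_sub_cancel_left]
  have hNU : N ⊆ U := fun D hD => by
    obtain ⟨-, h1, h2⟩ := hN D hD
    exact mem_filter.2 ⟨mem_univ _, h1, subset_univ _, h2.1⟩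
  classical
  set V : Finset (Finset α) := U.filter fun D => ¬ IsTight H m h A D with hV
  have hbad : (n - #A).choose m ≤ #V * (2 * m).choose m := by
    refine choose_le_card_not_isTight_mul (H := H) hm h0 hh hA ?_ ?_
    · intro D hAD hc ht
      exact mem_filter.2 ⟨mem_filter.2 ⟨mem_univ _, hAD, subset_univ _, hc⟩, ht⟩
    · intro D hD
      have := (mem_filter.1 (mem_filter.1 hD).1).2
      exact ⟨this.1, this.2.2⟩
  have hNV : #N + #V ≤ (n - #A).choose m := by
    rw [← hUcard, ← card_union_of_disjoint]
    · exact card_le_card (union_subset hNU (filter_subset _ _))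
    · rw [disjoint_left]
      exact fun D hD hD' => (mem_filter.1 hD').2 (hN D hD).2.2
  have hW : (0 : ℝ) < ((n - #A).choose m : ℝ) := by
    exact_mod_cast Nat.choose_pos (by omega)
  have hW' : (0 : ℝ) < ((2 * m).choose m : ℝ) := by
    exact_mod_cast Nat.choose_pos (by omega)
  calc ∑ B ∈ N, (#(block H A B) : ℝ)
      ≤ ∑ B ∈ N, #(block H A univ) * (1 / ((n - #A).choose m : ℝ)) := by
        refine sum_le_sum fun B hB => ?_
        obtain ⟨hBH, hAB, ht⟩ := hN B hB
        have h1 := card_block_filter H hAB (subset_univ B)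
        rw [card_univ, ← hn, ht.1, Nat.add_sub_cancel_left] at h1
        rw [← h1]
        norm_cast
        refine card_le_card fun f hf => ?_
        rw [mem_block] at hf
        rw [mem_filter, mem_block]
        exact ⟨⟨hf.1, isPrefix_univ f, fun D hD h => ⟨(hf.2.2 D hD h).1, subset_univ _⟩⟩, hf.2.1⟩
    _ = (#N / ((n - #A).choose m : ℝ)) * #(block H A univ) := by
        rw [sum_const, nsmul_eq_mul]; ring
    _ ≤ _ := by
        refine mul_le_mul_of_nonneg_right ?_ (Nat.cast_nonneg _)
        rw [div_le_iff₀ hW]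
        have h1 : ((n - #A).choose m : ℝ) / ((2 * m).choose m : ℝ) ≤ #V := by
          rw [div_le_iff₀ hW']; exact_mod_cast hbad
        have h2 : (#N : ℝ) + #V ≤ ((n - #A).choose m : ℝ) := by exact_mod_cast hNV
        have h3 : (1 - 1 / ((2 * m).choose m : ℝ)) * ((n - #A).choose m : ℝ)
            = ((n - #A).choose m : ℝ) - ((n - #A).choose m : ℝ) / ((2 * m).choose m : ℝ) := by ring
        linarith

/-- The gain in `card_le_of_card_Ioo_inter_le` over the bound given by the interval lemma. -/
noncomputable def strictGain (m : ℕ) : ℝ :=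
  1 / ((m.choose (m / 2) : ℝ) * (m.choose (m / 2) + 1)) * (1 / ((2 * m).choose m : ℝ))

lemma strictGain_pos (m : ℕ) : 0 < strictGain m := by
  have h1 : (0 : ℝ) < (m.choose (m / 2) : ℝ) := by
    exact_mod_cast Nat.choose_pos (Nat.div_le_self _ _)
  have h2 : (0 : ℝ) < ((2 * m).choose m : ℝ) := by
    exact_mod_cast Nat.choose_pos (by omega)
  unfold strictGain
  positivity

lemma strictGain_le_one (m : ℕ) : strictGain m ≤ 1 := by
  have h1 : (1 : ℝ) ≤ (m.choose (m / 2) : ℝ) := by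
    exact_mod_cast Nat.choose_pos (Nat.div_le_self _ _)
  have h2 : (1 : ℝ) ≤ ((2 * m).choose m : ℝ) := by
    exact_mod_cast Nat.choose_pos (by omega)
  unfold strictGain
  refine mul_le_one₀ ?_ (by positivity) ?_
  · rw [div_le_one (by positivity)]; nlinarith
  · rw [div_le_one (by positivity)]; exact h2

/-- The size of a family in which every interval between two members misses at least `h` sets,
compared to a Boolean lattice of rank `m`, is smaller by a constant factor than what is obtained
by treating each interval separately. -/
lemma card_le_of_card_Ioo_inter_le {H : Finset (Finset α)} {m h : ℕ} (hm : 2 ≤ m) (h0 : 0 < h)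
    (hh : h < m.choose (m / 2)) (hsize : ∀ A ∈ H, #A + 2 * m ≤ Fintype.card α)
    (hcard : ∀ A ∈ H, ∀ B ∈ H, A ⊂ B → #(Ioo A B ∩ H) + h + 2 ≤ 2 ^ m) :
    (#H : ℝ) ≤ (m + 1 - h / (m.choose (m / 2) : ℝ) - strictGain m)
      * (Fintype.card α).choose (Fintype.card α / 2) := by
  classical
  have hM : (0 : ℝ) < (m.choose (m / 2) : ℝ) := by exact_mod_cast (Nat.zero_le _).trans_lt hh
  set γ : ℝ := m + 1 - h / (m.choose (m / 2) : ℝ) with hγ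
  set c : ℝ := 1 / ((m.choose (m / 2) : ℝ) * (m.choose (m / 2) + 1)) with hc
  have hc0 : 0 ≤ c := by positivity
  have hγ1 : 1 ≤ γ := by
    have h1 : (h : ℝ) / (m.choose (m / 2) : ℝ) ≤ 1 := by
      rw [div_le_one hM]; exact_mod_cast hh.le
    have h2 : (2 : ℝ) ≤ m := by exact_mod_cast hm
    linarith
  refine card_le_of_forall_block_left (by linarith [strictGain_le_one m]) fun A hA => ?_
  set N := H.filter fun B => A ⊆ B ∧ IsTight H m h A B with hN
  have h1 := sum_card_block_isTight_le (N := N) hm h0 hh (hsize A hA)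
    fun D hD => ⟨(mem_filter.1 hD).1, (mem_filter.1 hD).2.1, (mem_filter.1 hD).2.2⟩
  -- Blocks that are not tight gain `c` and tight ones gain nothing. For fixed `A` the tight ones
  -- hold at most a fraction `1 - 1 / (2 * m).choose m` of the chains, so `c / (2 * m).choose m`
  -- survives.
  have h2 : ∀ B ∈ H, (#(block H A B) : ℝ) * lubell H A B
      ≤ (γ - c) * #(block H A B) + c * if A ⊆ B ∧ IsTight H m h A B then (#(block H A B) : ℝ) else 0 := by
    intro B hB
    rcases (block H A B).eq_empty_or_nonempty with he | hne
    · simp [he]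
    · have hAB := subset_of_block_nonempty hB hne
      split_ifs with ht
      · have := mul_le_mul_of_nonneg_left (lubell_le_of_lt hm hh hcard hA hB hAB)
          (Nat.cast_nonneg (α := ℝ) #(block H A B))
        rw [← hγ] at this
        linarith
      · have := mul_le_mul_of_nonneg_left (lubell_le_of_not_isTight hm hh hcard hA hB hAB
          fun h => ht ⟨hAB, h⟩) (Nat.cast_nonneg (α := ℝ) #(block H A B))
        rw [← hγ, ← hc] at this
        linarith
  rw [sum_block_univ_chainCount]
  refine (sum_le_sum h2).trans ?_
  rw [sum_add_distrib, ← mul_sum, ← mul_sum, sum_card_block H hA]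
  rw [show ∑ B ∈ H, (if A ⊆ B ∧ IsTight H m h A B then (#(block H A B) : ℝ) else 0)
    = ∑ B ∈ N, (#(block H A B) : ℝ) by rw [hN, sum_filter]]
  have h3 := mul_le_mul_of_nonneg_left h1 hc0
  have h4 : strictGain m = c * (1 / ((2 * m).choose m : ℝ)) := rfl
  rw [h4]
  linarith

end Strict

/-! ### Copies of `K_{r,s,t}`, and the low, high and middle parts of a free family. -/

section Posets

open Finset

/-- Inclusions from bottom to top follow through any middle set, which exists because `1 ≤ s`. -/
lemma containsPoset_K_iff {n r s t : ℕ} {F : Finset (Finset (Fin n))} (hs : 1 ≤ s) :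
    ContainsPoset F (K r s t) ↔ ∃ X Y Z : Finset (Finset (Fin n)), X ⊆ F ∧ Y ⊆ F ∧ Z ⊆ F ∧
      #X = r ∧ #Y = s ∧ #Z = t ∧ (∀ x ∈ X, ∀ y ∈ Y, x ⊂ y) ∧ ∀ y ∈ Y, ∀ z ∈ Z, y ⊂ z := by
  constructor
  · rintro ⟨i, hinj, hmono⟩
    set L : Fin 3 → Finset (Finset (Fin n)) := fun l =>
      univ.image fun a : Fin (![r, s, t] l) => (i ⟨l, a⟩ : Finset (Fin n)) with hL
    have hLF : ∀ l, L l ⊆ F := by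
      intro l D hD
      obtain ⟨a, -, rfl⟩ := mem_image.1 hD
      exact (i ⟨l, a⟩).2
    have hLc : ∀ l, #(L l) = ![r, s, t] l := by
      intro l
      rw [hL, card_image_of_injective, card_univ, Fintype.card_fin]
      intro a b hab
      exact eq_of_heq (Sigma.mk.inj_iff.1 (hinj (Subtype.ext hab))).2
    have hLlt : ∀ l l', l < l' → ∀ x ∈ L l, ∀ y ∈ L l', x ⊂ y := by
      intro l l' hll x hx y hy
      obtain ⟨a, -, rfl⟩ := mem_image.1 hx
      obtain ⟨b, -, rfl⟩ := mem_image.1 hy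
      refine ssubset_of_subset_of_ne (hmono ⟨l, a⟩ ⟨l', b⟩ (Or.inr hll)) fun h => ?_
      have := hinj (Subtype.ext h)
      exact hll.ne (congrArg Sigma.fst this)
    exact ⟨L 0, L 1, L 2, hLF 0, hLF 1, hLF 2, hLc 0, hLc 1, hLc 2,
      hLlt 0 1 (by decide), hLlt 1 2 (by decide)⟩
  · rintro ⟨X, Y, Z, hX, hY, hZ, hXc, hYc, hZc, hXY, hYZ⟩
    set L : Fin 3 → Finset (Finset (Fin n)) := ![X, Y, Z] with hL
    have hLF : ∀ l, L l ⊆ F := by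
      intro l; fin_cases l <;> assumption
    have hLc : ∀ l, #(L l) = ![r, s, t] l := by
      intro l; fin_cases l <;> assumption
    have hXZ : ∀ x ∈ X, ∀ z ∈ Z, x ⊂ z := by
      intro x hx z hz
      obtain ⟨y, hy⟩ := card_pos.1 (hYc ▸ hs : 0 < #Y)
      exact (hXY x hx y hy).trans (hYZ y hy z hz)
    have hLlt : ∀ l l', l < l' → ∀ x ∈ L l, ∀ y ∈ L l', x ⊂ y := by
      intro l l' hll
      fin_cases l <;> fin_cases l' <;> first | exact absurd hll (by decide) | assumption
    let e : ∀ l, Fin (![r, s, t] l) ≃ L l := fun l => (equivFinOfCardEq (hLc l)).symm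
    refine ⟨fun p => ⟨(e p.1 p.2 : Finset (Fin n)), hLF _ (e p.1 p.2).2⟩, ?_, ?_⟩
    · rintro ⟨l, a⟩ ⟨l', b⟩ hab
      have hab' : (e l a : Finset (Fin n)) = e l' b := congrArg Subtype.val hab
      rcases lt_trichotomy l l' with h | rfl | h
      · exact absurd hab' (hLlt l l' h _ (e l a).2 _ (e l' b).2).ne
      · rw [(e l).injective (Subtype.ext hab')]
      · exact absurd hab'.symm (hLlt l' l h _ (e l' b).2 _ (e l a).2).ne
    · rintro p q (rfl | h)
      · exact subset_rfl
      · exact (hLlt _ _ h _ (e p.1 p.2).2 _ (e q.1 q.2).2).1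

lemma f_eq (r t : ℕ) : f r t = (if r = 1 then 0 else 1) + if t = 1 then 0 else 1 := by
  unfold f
  split_ifs <;> simp_all

/-- In a `K_{r,s,t}`-free family, few members lie between two members that have enough members
below and above them. -/
lemma card_Ioo_inter_add_le {n r s t : ℕ} (hs : f r t + 2 ≤ s) {F : Finset (Finset (Fin n))}
    (hF : PosetFree F (K r s t)) {A B : Finset (Fin n)} (hA : A ∈ F) (hB : B ∈ F) (hAB : A ⊂ B)
    (hlow : r ≠ 1 → r ≤ #(F.filter fun D => D ⊂ A))
    (hhigh : t ≠ 1 → t ≤ #(F.filter fun D => B ⊂ D)) :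
    #(Ioo A B ∩ F) + f r t + 1 ≤ s := by
  by_contra hcon
  refine hF ((containsPoset_K_iff (by omega)).2 ?_)
  obtain ⟨X, hXF, hXc, hXA⟩ : ∃ X ⊆ F, #X = r ∧ ∀ x ∈ X, if r = 1 then x = A else x ⊂ A := by
    by_cases hr : r = 1
    · exact ⟨{A}, by simpa using hA, by simp [hr], by simp [hr]⟩
    · obtain ⟨X, hX, hXc⟩ := exists_subset_card_eq (hlow hr)
      refine ⟨X, hX.trans (filter_subset _ _), hXc, fun x hx => ?_⟩
      rw [if_neg hr]
      exact (mem_filter.1 (hX hx)).2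
  obtain ⟨Z, hZF, hZc, hZB⟩ : ∃ Z ⊆ F, #Z = t ∧ ∀ z ∈ Z, if t = 1 then z = B else B ⊂ z := by
    by_cases ht : t = 1
    · exact ⟨{B}, by simpa using hB, by simp [ht], by simp [ht]⟩
    · obtain ⟨Z, hZ, hZc⟩ := exists_subset_card_eq (hhigh ht)
      refine ⟨Z, hZ.trans (filter_subset _ _), hZc, fun z hz => ?_⟩
      rw [if_neg ht]
      exact (mem_filter.1 (hZ hz)).2
  -- If `r = 1`, then `A` is itself the bottom; otherwise the bottom lies strictly below `A`, which
  -- frees `A` for the middle. The same holds for `t` and `B`, so `f r t` counts the endpoints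
  -- gained for the middle level.
  set Y : Finset (Finset (Fin n)) :=
    (if r = 1 then ∅ else {A}) ∪ ((if t = 1 then ∅ else {B}) ∪ (Ioo A B ∩ F)) with hY
  have hYc : s ≤ #Y := by
    rw [hY, card_union_of_disjoint, card_union_of_disjoint]
    · rw [f_eq] at hcon
      split_ifs at hcon ⊢ <;> simp <;> omega
    · split_ifs <;> simp
    · split_ifs <;> simp [hAB.ne]
  obtain ⟨Y', hY', hYc'⟩ := exists_subset_card_eq hYc
  have hmem : ∀ y ∈ Y', y ∈ F ∧ (y = A ∧ r ≠ 1 ∨ A ⊂ y) ∧ (y = B ∧ t ≠ 1 ∨ y ⊂ B) := by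
    intro y hy
    have h := hY' hy
    rw [hY, mem_union, mem_union, mem_inter, mem_Ioo] at h
    rcases h with h | h | ⟨h, h'⟩
    · split_ifs at h with hr
      · simp at h
      · rw [mem_singleton] at h
        subst h
        exact ⟨hA, Or.inl ⟨rfl, hr⟩, Or.inr hAB⟩
    · split_ifs at h with hr
      · simp at h
      · rw [mem_singleton] at h
        subst h
        exact ⟨hB, Or.inr hAB, Or.inl ⟨rfl, hr⟩⟩
    · exact ⟨h', Or.inr h.1, Or.inr h.2⟩
  refine ⟨X, Y', Z, hXF, fun y hy => (hmem y hy).1, hZF, hXc, hYc', hZc, ?_, ?_⟩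
  · intro x hx y hy
    have h1 := hXA x hx
    obtain ⟨-, h2, -⟩ := hmem y hy
    split_ifs at h1 with hr
    · subst h1
      exact h2.resolve_left fun h => h.2 hr
    · rcases h2 with ⟨rfl, -⟩ | h2
      · exact h1
      · exact h1.trans h2
  · intro y hy z hz
    have h1 := hZB z hz
    obtain ⟨-, -, h2⟩ := hmem y hy
    split_ifs at h1 with ht
    · subst h1
      exact h2.resolve_left fun h => h.2 ht
    · rcases h2 with ⟨rfl, -⟩ | h2
      · exact h1
      · exact h2.trans h1

/-- The members of `F` that contain fewer than `r` other members, provided `r ≠ 1`. -/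
def lowPart {n : ℕ} (F : Finset (Finset (Fin n))) (r : ℕ) : Finset (Finset (Fin n)) :=
  F.filter fun A => r ≠ 1 ∧ #(F.filter fun D => D ⊂ A) < r

/-- The members of `F` that are contained in fewer than `t` other members, provided `t ≠ 1`. -/
def highPart {n : ℕ} (F : Finset (Finset (Fin n))) (t : ℕ) : Finset (Finset (Fin n)) :=
  F.filter fun A => t ≠ 1 ∧ #(F.filter fun D => A ⊂ D) < t

lemma card_le_lowPart_add {n : ℕ} (F : Finset (Finset (Fin n))) (r t : ℕ) :
    #F ≤ #(lowPart F r) + #(highPart F t) + #(F \ (lowPart F r ∪ highPart F t)) := by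
  have h1 := card_le_card_sdiff_add_card (s := F) (t := lowPart F r ∪ highPart F t)
  have h2 := card_union_le (lowPart F r) (highPart F t)
  omega

/-- At most `s - f r t - 1` inner sets remain, out of `2 ^ m - 2` in rank `m`; this is where `h = 2
^ m - 1 - (s - f r t)` comes from. Sets below `A` and above `B` are counted in `F`, so the bound
passes to any subfamily `H` of the middle part. -/
lemma card_Ioo_inter_middlePart {n r s t m : ℕ} (hs : f r t + 2 ≤ s) (hsm : s + 2 ≤ 2 ^ m + f r t)
    {F : Finset (Finset (Fin n))} (hF : PosetFree F (K r s t)) {H : Finset (Finset (Fin n))}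
    (hH : H ⊆ F \ (lowPart F r ∪ highPart F t)) {A B : Finset (Fin n)} (hA : A ∈ H) (hB : B ∈ H)
    (hAB : A ⊂ B) : #(Ioo A B ∩ H) + (2 ^ m - 1 - (s - f r t)) + 2 ≤ 2 ^ m := by
  have hmem : ∀ D ∈ H, D ∈ F ∧ (r ≠ 1 → r ≤ #(F.filter fun E => E ⊂ D)) ∧
      (t ≠ 1 → t ≤ #(F.filter fun E => D ⊂ E)) := by
    intro D hD
    have h := hH hD
    rw [Finset.mem_sdiff, mem_union, lowPart, highPart, mem_filter, mem_filter] at h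
    obtain ⟨h1, h2⟩ := h
    push Not at h2
    exact ⟨h1, h2.1 h1, h2.2 h1⟩
  obtain ⟨hAF, hA1, -⟩ := hmem A hA
  obtain ⟨hBF, -, hB1⟩ := hmem B hB
  have h1 := card_Ioo_inter_add_le hs hF hAF hBF hAB hA1 hB1
  have h2 : #(Ioo A B ∩ H) ≤ #(Ioo A B ∩ F) :=
    card_le_card (inter_subset_inter_left (hH.trans sdiff_subset))
  omega

lemma exists_card_eq_La (n : ℕ) (P : Type) [PartialOrder P] (h : PosetFree (∅ : Finset (Finset (Fin n))) P) :
    ∃ F : Finset (Finset (Fin n)), PosetFree F P ∧ #F = La n P := by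
  classical
  obtain ⟨F, hF, hc⟩ := exists_mem_eq_sup
    (univ.filter fun F : Finset (Finset (Fin n)) => PosetFree F P) ⟨∅, by simpa using h⟩ card
  refine ⟨F, (mem_filter.1 hF).2, ?_⟩
  rw [La, ← hc]

lemma card_le_La {n : ℕ} {P : Type} [PartialOrder P] {F : Finset (Finset (Fin n))}
    (h : PosetFree F P) : #F ≤ La n P := by
  classical
  exact le_sup (f := card) (by simpa using h)

end Posets

/-! ### Binomial coefficients near the middle and far from it. -/

section Binomials

lemma choose_mul_one_add_le {n j : ℕ} {δ : ℝ} (hδ : 0 < δ)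
    (hj : ((j : ℝ) + 1) ≤ (1 / 2 - δ / 2) * n) :
    (n.choose j : ℝ) * (1 + δ) ≤ n.choose (j + 1) := by
  have hn : (0 : ℝ) ≤ n := Nat.cast_nonneg n
  have hjn : (j : ℝ) ≤ n / 2 := by nlinarith
  have hle : j ≤ n := by
    have : (j : ℝ) ≤ n := by linarith
    exact_mod_cast this
  have h := Nat.choose_succ_right_eq n j
  have h' : (n.choose (j + 1) : ℝ) * (j + 1) = n.choose j * (n - j) := by
    rw [← Nat.cast_sub hle]; exact_mod_cast h
  have h1 : (1 + δ) * ((j : ℝ) + 1) ≤ n - j := by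
    have h2 := mul_le_mul_of_nonneg_left hj (by linarith : (0 : ℝ) ≤ 1 + δ)
    have h3 : 0 ≤ δ ^ 2 * n := by positivity
    nlinarith
  have h2 : (0 : ℝ) < (j : ℝ) + 1 := by positivity
  refine le_of_mul_le_mul_right ?_ h2
  rw [h', mul_assoc]
  exact mul_le_mul_of_nonneg_left h1 (Nat.cast_nonneg _)

lemma choose_mul_pow_le {n j : ℕ} {δ : ℝ} (hδ : 0 < δ) (k : ℕ)
    (hj : ((j : ℝ) + k) ≤ (1 / 2 - δ / 2) * n) :
    (n.choose j : ℝ) * (1 + δ) ^ k ≤ n.choose (j + k) := by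
  induction k with
  | zero => simp
  | succ k ih =>
    push_cast at hj
    have h1 := ih (by linarith)
    have h2 := choose_mul_one_add_le (n := n) (j := j + k) hδ (by push_cast; linarith)
    calc (n.choose j : ℝ) * (1 + δ) ^ (k + 1) = (n.choose j : ℝ) * (1 + δ) ^ k * (1 + δ) := by ring
      _ ≤ n.choose (j + k) * (1 + δ) := by gcongr
      _ ≤ _ := h2

open Finset in
lemma card_filter_card_le {α : Type*} [Fintype α] [DecidableEq α] (p : ℕ → Prop) [DecidablePred p]
    {x : ℝ} (hx : 0 ≤ x) (h : ∀ j, p j → ((Fintype.card α).choose j : ℝ) ≤ x) :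
    (#(univ.filter fun A : Finset α => p #A) : ℝ) ≤ (Fintype.card α + 1) * x := by
  rw [card_eq_sum_card_fiberwise (f := card) (t := range (Fintype.card α + 1))]
  · push_cast
    refine (sum_le_card_nsmul _ _ x fun j _ => ?_).trans (by simp)
    by_cases hj : p j
    · refine le_trans ?_ (h j hj)
      rw [← card_univ, ← card_powersetCard]
      norm_cast
      refine card_le_card fun A hA => ?_
      rw [mem_filter] at hA
      exact mem_powersetCard.2 ⟨subset_univ _, hA.2⟩
    · rw [filter_filter, filter_false_of_mem]
      · simpa using hx
      · rintro A - ⟨h1, rfl⟩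
        exact hj h1
  · intro A _
    simpa [Nat.lt_succ_iff] using card_le_univ A

lemma eventually_pow_floor {δ η : ℝ} (hδ : 0 < δ) (hη : 0 < η) :
    ∀ᶠ n : ℕ in atTop, (n : ℝ) * (n + 1) ≤ η * (1 + δ) ^ ⌊δ / 2 * n⌋₊ := by
  have h1 : Tendsto (fun n : ℕ => ⌊δ / 2 * (n : ℝ)⌋₊) atTop atTop :=
    tendsto_nat_floor_atTop.comp
      (tendsto_natCast_atTop_atTop.const_mul_atTop (by positivity))
  have h2 := (tendsto_pow_const_div_const_pow_of_one_lt 2 (by linarith : 1 < 1 + δ)).comp h1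
  -- Here `32 = 2 * 4 ^ 2`, from `n * (n + 1) ≤ 2 * n ^ 2` and `δ * n ≤ 4 * k`.
  have h3 : 0 < η * δ ^ 2 / 32 := by positivity
  filter_upwards [h2.eventually_le_const h3, h1.eventually_ge_atTop 1, eventually_ge_atTop 1]
    with n hn ht hn1
  set k := ⌊δ / 2 * (n : ℝ)⌋₊ with hk
  simp only [Function.comp_apply] at hn
  rw [div_le_iff₀ (by positivity)] at hn
  have hlt : δ / 2 * (n : ℝ) < k + 1 := Nat.lt_floor_add_one _
  have hk1 : (1 : ℝ) ≤ k := by exact_mod_cast ht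
  have hn1' : (1 : ℝ) ≤ n := by exact_mod_cast hn1
  have h4 : δ * n ≤ 4 * k := by linarith
  have h5 : (δ * n) ^ 2 ≤ (4 * k) ^ 2 := pow_le_pow_left₀ (by positivity) h4 2
  have h6 : δ ^ 2 * ((n : ℝ) * (n + 1)) ≤ δ ^ 2 * (η * (1 + δ) ^ k) := by
    have : δ ^ 2 * ((n : ℝ) * (n + 1)) ≤ 2 * (δ * n) ^ 2 := by
      have : 0 ≤ δ ^ 2 * (n * (n - 1)) := by
        have : (0 : ℝ) ≤ (n : ℝ) - 1 := by linarith
        positivity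
      nlinarith
    nlinarith
  exact le_of_mul_le_mul_left h6 (by positivity)

open Finset in
/-- Only few sets have size at most `(1 / 2 - δ) * n`. -/
lemma eventually_card_filter_small_le {δ η : ℝ} (hδ : 0 < δ) (hη : 0 < η) :
    ∀ᶠ n : ℕ in atTop, (#(univ.filter fun A : Finset (Fin n) => (#A : ℝ) ≤ (1 / 2 - δ) * n) : ℝ)
      ≤ η / n * n.choose (n / 2) := by
  filter_upwards [eventually_pow_floor hδ hη, eventually_ge_atTop 1] with n hn hn1
  have hn0 : (0 : ℝ) < n := by exact_mod_cast hn1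
  -- From a size at most `(1 / 2 - δ) * n`, these `k` steps upward stay below `(1 / 2 - δ / 2) * n`,
  -- and each multiplies the coefficient by at least `1 + δ`.
  set k := ⌊δ / 2 * (n : ℝ)⌋₊ with hk
  have hpow : (0 : ℝ) < (1 + δ) ^ k := by positivity
  have h1 := card_filter_card_le (α := Fin n) (fun j => (j : ℝ) ≤ (1 / 2 - δ) * n)
    (x := n.choose (n / 2) / (1 + δ) ^ k) (by positivity) ?_
  · refine h1.trans ?_
    rw [Fintype.card_fin, mul_div_assoc', div_le_iff₀ hpow, div_mul_eq_mul_div, div_mul_eq_mul_div,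
      le_div_iff₀ hn0]
    have := mul_le_mul_of_nonneg_right hn (Nat.cast_nonneg (α := ℝ) (n.choose (n / 2)))
    nlinarith
  · intro j hj
    rw [Fintype.card_fin, le_div_iff₀ hpow]
    have hfl : (k : ℝ) ≤ δ / 2 * n := Nat.floor_le (by positivity)
    refine (choose_mul_pow_le hδ k (by linarith)).trans ?_
    exact_mod_cast Nat.choose_le_middle _ _

/-- The step from distance `i` to `i + 1` loses at most `(4 * i + 4) / n` of the middle coefficient,
and these losses add up to `2 * i * (i + 1) / n`. -/
lemma choose_middle_sub_ge (n i : ℕ) (hi : i ≤ n / 2) :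
    ((n : ℝ) - 2 * i * (i + 1)) * n.choose (n / 2) ≤ n * n.choose (n / 2 - i) := by
  induction i with
  | zero => simp
  | succ i ih =>
    have h1 := ih (by omega)
    obtain ⟨j, hj⟩ : ∃ j, n / 2 - i = j + 1 := ⟨n / 2 - i - 1, by omega⟩
    rw [show n / 2 - (i + 1) = j by omega]
    rw [hj] at h1
    have h2 := Nat.choose_succ_right_eq n j
    have hjn : j ≤ n := by omega
    have h2' : (n.choose (j + 1) : ℝ) * (j + 1) = n.choose j * (n - j) := by
      rw [← Nat.cast_sub hjn]; exact_mod_cast h2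
    have h3 : (n.choose (j + 1) : ℝ) ≤ n.choose (n / 2) := by
      exact_mod_cast Nat.choose_le_middle _ _
    have h4 : (n : ℝ) ≤ 2 * j + 2 * i + 3 := by
      exact_mod_cast (by omega : n ≤ 2 * j + 2 * i + 3)
    have h5 : (2 : ℝ) * j + 2 ≤ n := by exact_mod_cast (by omega : 2 * j + 2 ≤ n)
    set C := (n.choose (n / 2) : ℝ)
    set x := (n.choose (j + 1) : ℝ) with hx
    set y := (n.choose j : ℝ) with hy
    have hx0 : 0 ≤ x := Nat.cast_nonneg _
    have hC0 : 0 ≤ C := Nat.cast_nonneg _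
    have hnj : (0 : ℝ) < n - j := by
      have : (0 : ℝ) ≤ j := Nat.cast_nonneg _
      linarith
    have h6 : (x - y) * n ≤ (4 * i + 4) * C := by
      have e1 : (x - y) * (n - j) = x * (n - 2 * j - 1) := by linarith
      have e2 : x * (n - 2 * j - 1) ≤ x * (2 * i + 2) :=
        mul_le_mul_of_nonneg_left (by linarith) hx0
      have e3 : x * (2 * i + 2) ≤ C * (2 * i + 2) :=
        mul_le_mul_of_nonneg_right h3 (by positivity)
      rcases le_or_gt (x - y) 0 with h | h
      · have : (x - y) * n ≤ 0 := mul_nonpos_of_nonpos_of_nonneg h (Nat.cast_nonneg _)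
        have : 0 ≤ (4 * (i : ℝ) + 4) * C := by positivity
        linarith
      · have e4 : (x - y) * n ≤ (x - y) * (2 * (n - j)) :=
          mul_le_mul_of_nonneg_left (by linarith) h.le
        linarith
    push_cast
    nlinarith

lemma choose_near_middle_ge {n j a : ℕ} (hj : j ≤ n) (h1 : n ≤ 2 * j + a) (h2 : 2 * j ≤ n + a) :
    ((n : ℝ) - 2 * a * (a + 1)) * n.choose (n / 2) ≤ n * n.choose j := by
  have key : ∀ j, j ≤ n / 2 → n ≤ 2 * j + a →
      ((n : ℝ) - 2 * a * (a + 1)) * n.choose (n / 2) ≤ n * n.choose j := by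
    intro j hj hja
    have h := choose_middle_sub_ge n (n / 2 - j) (Nat.sub_le _ _)
    rw [Nat.sub_sub_self hj] at h
    refine le_trans ?_ h
    refine mul_le_mul_of_nonneg_right ?_ (Nat.cast_nonneg _)
    have h3 : ((n / 2 - j : ℕ) : ℝ) ≤ a := by exact_mod_cast (by omega : n / 2 - j ≤ a)
    have h4 : (0 : ℝ) ≤ ((n / 2 - j : ℕ) : ℝ) := Nat.cast_nonneg _
    nlinarith
  rcases le_or_gt j (n / 2) with h | h
  · exact key j h h1
  · rw [← Nat.choose_symm hj]
    exact key _ (by omega) (by omega)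

lemma choose_half_succ (n : ℕ) : n.choose ((n + 1) / 2) = n.choose (n / 2) := by
  rw [← Nat.choose_symm (by omega : (n + 1) / 2 ≤ n)]
  congr 1
  omega

lemma chooseInt_le_middle (n : ℕ) (j : ℤ) : chooseInt n j ≤ n.choose (n / 2) := by
  unfold chooseInt
  split_ifs
  · exact Nat.choose_le_middle _ _
  · exact Nat.zero_le _

lemma sigmaSum_le (n k : ℕ) : sigmaSum n k ≤ k * n.choose (n / 2) := by
  unfold sigmaSum
  refine (Finset.sum_le_card_nsmul _ _ _ fun i _ => chooseInt_le_middle n _).trans ?_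
  simp

lemma sigmaSum_ge {n k : ℕ} (hn : k ≤ n) :
    (k : ℝ) * (((n : ℝ) - 2 * k * (k + 1)) * n.choose (n / 2)) ≤ n * sigmaSum n k := by
  unfold sigmaSum
  push_cast
  rw [Finset.mul_sum]
  have h : ∀ i ∈ Finset.Icc 1 k, ((n : ℝ) - 2 * k * (k + 1)) * n.choose (n / 2)
      ≤ n * (chooseInt n (((n : ℤ) - k) / 2 + i) : ℝ) := by
    intro i hi
    rw [Finset.mem_Icc] at hi
    unfold chooseInt
    rw [if_pos (by omega)]
    exact choose_near_middle_ge (by omega) (by omega) (by omega)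
  refine le_trans ?_ (Finset.sum_le_sum h)
  simp

open Finset in
lemma card_consecutiveLevels (n : ℕ) (j : ℤ) (k : ℕ) :
    #(consecutiveLevels n j k) = ∑ i ∈ Icc 1 k, chooseInt n (j + i) := by
  have h : consecutiveLevels n j k = (Icc 1 k).biUnion fun i =>
      univ.filter fun A : Finset (Fin n) => (#A : ℤ) = j + i := by
    ext A
    simp only [consecutiveLevels, mem_filter, mem_univ, true_and, mem_biUnion, mem_Icc]
    constructor
    · rintro ⟨h1, h2⟩
      exact ⟨(#A - j).toNat, by omega, by omega⟩
    · rintro ⟨i, h1, h2⟩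
      omega
  rw [h, card_biUnion]
  · refine sum_congr rfl fun i _ => ?_
    unfold chooseInt
    split_ifs with h0
    · have h1 := card_powersetCard (j + i).toNat (univ : Finset (Fin n))
      rw [card_univ, Fintype.card_fin] at h1
      rw [← h1]
      congr 1
      ext A
      simp only [mem_filter, mem_univ, true_and, mem_powersetCard, subset_univ]
      omega
    · rw [card_eq_zero, filter_eq_empty_iff]
      intro A _
      omega
  · intro i _ i' _ hne
    rw [Function.onFun, disjoint_left]
    intro A h1 h2
    rw [mem_filter] at h1 h2
    omega

end Binomials

/-! ### Upper bounds for `La`. -/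

section Upper

open Finset

/-- A family in which every member contains at most `k` other members has at most
`(1 + (2 * k + ε) / n) * n.choose (n / 2)` members. -/
lemma eventually_card_le_of_card_lower_le (k : ℕ) {ε : ℝ} (hε : 0 < ε) :
    ∀ᶠ n : ℕ in atTop, ∀ H : Finset (Finset (Fin n)),
      (∀ B ∈ H, #(H.filter fun A => A ⊂ B) ≤ k) →
      (#H : ℝ) ≤ (1 + (2 * k + ε) / n) * n.choose (n / 2) := by
  -- Small enough that `k / (1 / 2 - δ) ≤ 2 * k + ε / 2`; the other `ε / 2` pays for the sets of
  -- size at most `(1 / 2 - δ) * n`.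
  set δ : ℝ := ε / (8 * (k + ε + 1)) with hδ
  have hden : (0 : ℝ) < 8 * (k + ε + 1) := by positivity
  have hδ0 : 0 < δ := by positivity
  have hδeq : δ * (8 * (k + ε + 1)) = ε := div_mul_cancel₀ _ hden.ne'
  have hk : (0 : ℝ) ≤ k := Nat.cast_nonneg k
  have hδ1 : δ < 1 / 4 := by nlinarith
  filter_upwards [eventually_card_filter_small_le hδ0 (half_pos hε), eventually_ge_atTop 1]
    with n hn hn1 H hH
  have hn0 : (0 : ℝ) < n := by exact_mod_cast hn1
  set H₁ := H.filter fun A => (#A : ℝ) ≤ (1 / 2 - δ) * n with hH₁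
  set H₂ := H.filter fun A => ¬ (#A : ℝ) ≤ (1 / 2 - δ) * n with hH₂
  have hsplit : (#H : ℝ) = #H₁ + #H₂ := by
    rw [hH₁, hH₂]
    exact_mod_cast (card_filter_add_card_filter_not (s := H) _).symm
  have h1 : (#H₁ : ℝ) ≤ ε / 2 / n * n.choose (n / 2) := by
    refine le_trans ?_ hn
    exact_mod_cast card_le_card (filter_subset_filter _ (subset_univ H))
  have hb : 0 < (1 / 2 - δ) * n := mul_pos (by linarith) hn0
  have h2 := card_le_of_card_lower_le (H := H₂) (k := k) hb
    (fun A hA => (not_le.1 (mem_filter.1 hA).2).le)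
    (fun B hB => (card_le_card (filter_subset_filter _ (filter_subset _ _))).trans
      (hH B (mem_filter.1 hB).1))
  rw [Fintype.card_fin] at h2
  have h3 : (k : ℝ) / ((1 / 2 - δ) * n) ≤ (2 * k + ε / 2) / n := by
    rw [div_le_div_iff₀ hb hn0]
    have : (k : ℝ) ≤ (2 * k + ε / 2) * (1 / 2 - δ) := by nlinarith
    nlinarith
  have hC : (0 : ℝ) ≤ n.choose (n / 2) := Nat.cast_nonneg _
  have h4 := mul_le_mul_of_nonneg_right h3 hC
  have h5 : (2 * k + ε) / n = (2 * k + ε / 2) / n + ε / 2 / n := by ring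
  rw [h5, hsplit]
  linarith

/-- Complementation reverses inclusion and reduces this to the previous bound. -/
lemma eventually_card_le_of_card_upper_le (k : ℕ) {ε : ℝ} (hε : 0 < ε) :
    ∀ᶠ n : ℕ in atTop, ∀ H : Finset (Finset (Fin n)),
      (∀ B ∈ H, #(H.filter fun A => B ⊂ A) ≤ k) →
      (#H : ℝ) ≤ (1 + (2 * k + ε) / n) * n.choose (n / 2) := by
  filter_upwards [eventually_card_le_of_card_lower_le k hε] with n hn H hH
  have h1 := hn (H.image compl) fun A hA => by
    obtain ⟨B, hB, rfl⟩ := mem_image.1 hA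
    refine le_trans ?_ (hH B hB)
    rw [filter_image, card_image_of_injective _ compl_injective]
    refine card_le_card fun D hD => ?_
    rw [mem_filter] at hD ⊢
    exact ⟨hD.1, compl_ssubset_compl.1 hD.2⟩
  rwa [card_image_of_injective _ compl_injective] at h1

lemma eventually_card_lowPart_le {r : ℕ} (hr : 1 ≤ r) {ε : ℝ} (hε : 0 < ε) :
    ∀ᶠ n : ℕ in atTop, ∀ F : Finset (Finset (Fin n)), (#(lowPart F r) : ℝ)
      ≤ ((if r = 1 then 0 else 1 : ℕ) + (2 * ((r : ℝ) - 1) + ε) / n) * n.choose (n / 2) := by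
  by_cases h1 : r = 1
  · subst h1
    refine Eventually.of_forall fun n F => ?_
    have : lowPart F 1 = ∅ := by simp [lowPart]
    rw [this]
    simp only [card_empty, Nat.cast_zero, if_true, Nat.cast_one, sub_self, mul_zero, zero_add]
    positivity
  · filter_upwards [eventually_card_le_of_card_lower_le (r - 1) hε] with n hn F
    rw [if_neg h1]
    have h2 := hn (lowPart F r) fun B hB => by
      have h3 := (mem_filter.1 hB).2.2
      have hsub : lowPart F r ⊆ F := filter_subset _ _
      have h4 := card_le_card (filter_subset_filter (fun A => A ⊂ B) hsub)
      omega
    rw [Nat.cast_sub hr] at h2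
    exact_mod_cast h2

lemma eventually_card_highPart_le {t : ℕ} (ht : 1 ≤ t) {ε : ℝ} (hε : 0 < ε) :
    ∀ᶠ n : ℕ in atTop, ∀ F : Finset (Finset (Fin n)), (#(highPart F t) : ℝ)
      ≤ ((if t = 1 then 0 else 1 : ℕ) + (2 * ((t : ℝ) - 1) + ε) / n) * n.choose (n / 2) := by
  by_cases h1 : t = 1
  · subst h1
    refine Eventually.of_forall fun n F => ?_
    have : highPart F 1 = ∅ := by simp [highPart]
    rw [this]
    simp only [card_empty, Nat.cast_zero, if_true, Nat.cast_one, sub_self, mul_zero, zero_add]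
    positivity
  · filter_upwards [eventually_card_le_of_card_upper_le (t - 1) hε] with n hn F
    rw [if_neg h1]
    have h2 := hn (highPart F t) fun B hB => by
      have h3 := (mem_filter.1 hB).2.2
      have hsub : highPart F t ⊆ F := filter_subset _ _
      have h4 := card_le_card (filter_subset_filter (fun A => B ⊂ A) hsub)
      omega
    rw [Nat.cast_sub ht] at h2
    exact_mod_cast h2

lemma posetFree_empty {n r s t : ℕ} (hs : 1 ≤ s) :
    PosetFree (∅ : Finset (Finset (Fin n))) (K r s t) := by
  rw [PosetFree, containsPoset_K_iff hs]
  rintro ⟨X, Y, Z, -, hY, -, -, hc, -⟩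
  rw [subset_empty.1 hY, card_empty] at hc
  omega

/-- An upper bound `x * n.choose (n / 2)` for the middle part gives an upper bound for `La`. -/
lemma eventually_La_le {r s t : ℕ} (hr : 1 ≤ r) (ht : 1 ≤ t) (hs : 1 ≤ s) {x : ℝ}
    (hx : ∀ᶠ n : ℕ in atTop, ∀ F : Finset (Finset (Fin n)), PosetFree F (K r s t) →
      (#(F \ (lowPart F r ∪ highPart F t)) : ℝ) ≤ x * n.choose (n / 2)) {ε : ℝ} (hε : 0 < ε) :
    ∀ᶠ n : ℕ in atTop, (La n (K r s t) : ℝ)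
      ≤ (x + f r t + (2 * ((r : ℝ) + t - 2) + ε) / n) * n.choose (n / 2) := by
  filter_upwards [hx, eventually_card_lowPart_le hr (half_pos hε),
    eventually_card_highPart_le ht (half_pos hε)] with n h1 h2 h3
  obtain ⟨F, hF, hFc⟩ := exists_card_eq_La n (K r s t) (posetFree_empty hs)
  have h4 : (#F : ℝ) ≤ #(lowPart F r) + #(highPart F t) + #(F \ (lowPart F r ∪ highPart F t)) := by
    exact_mod_cast card_le_lowPart_add F r t
  rw [← hFc, f_eq]
  refine h4.trans ((add_le_add (add_le_add (h2 F) (h3 F)) (h1 F hF)).trans (le_of_eq ?_))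
  push_cast
  ring

/-- The condition `hM` says that `h` is at least the middle coefficient, so the maximum in
`lubell_le_max` is `m`. -/
lemma eventually_La_le_of_middle_le {r s t m : ℕ} (hr : 1 ≤ r) (ht : 1 ≤ t) (hm : 2 ≤ m)
    (hs : f r t + 2 ≤ s) (hM : s + m.choose (m / 2) + 1 ≤ 2 ^ m + f r t) {ε : ℝ} (hε : 0 < ε) :
    ∀ᶠ n : ℕ in atTop, (La n (K r s t) : ℝ)
      ≤ (m + f r t + (2 * ((r : ℝ) + t - 2) + ε) / n) * n.choose (n / 2) := by
  refine eventually_La_le hr ht (by omega) (Eventually.of_forall fun n F hF => ?_) hε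
  have hM2 := Nat.two_le_choose_middle hm
  have hM0 : (0 : ℝ) < (m.choose (m / 2) : ℝ) := by exact_mod_cast (by omega)
  have h := card_le_of_lubell_le (H := F \ (lowPart F r ∪ highPart F t)) (γ := m)
    (Nat.cast_nonneg m) fun A hA B hB hAB => ?_
  · rwa [Fintype.card_fin] at h
  · refine (lubell_le_max hm (fun A hA B hB hAB => card_Ioo_inter_middlePart (m := m) hs (by omega)
      hF subset_rfl hA hB hAB) hA hB hAB).trans (max_le le_rfl ?_)
    have : 1 ≤ ((2 ^ m - 1 - (s - f r t) : ℕ) : ℝ) / (m.choose (m / 2) : ℝ) := by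
      rw [one_le_div hM0]
      exact_mod_cast (by omega)
    linarith

/-- Half of `strictGain` absorbs the few sets too large for the strict bound, the other half the
`O(1 / n)` from the low and high parts, so the final constant carries no error term. -/
lemma eventually_La_le_of_lt_middle {r s t m : ℕ} (hr : 1 ≤ r) (ht : 1 ≤ t) (hm : 2 ≤ m)
    (hs : f r t + 2 ≤ s) (hsm : s + 2 ≤ 2 ^ m + f r t)
    (hM : 2 ^ m + f r t ≤ s + m.choose (m / 2)) :
    ∀ᶠ n : ℕ in atTop, (La n (K r s t) : ℝ)
      ≤ (m + f r t + 1 - ((2 : ℝ) ^ m - s + f r t - 1) / (m.choose (m / 2) : ℝ))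
        * n.choose (n / 2) := by
  set h : ℕ := 2 ^ m - 1 - (s - f r t) with hh
  have hcast : (h : ℝ) = (2 : ℝ) ^ m - s + f r t - 1 := by
    have h1 : h + s + 1 = 2 ^ m + f r t := by omega
    have h2 : (h : ℝ) + s + 1 = 2 ^ m + f r t := by exact_mod_cast h1
    linarith
  rw [← hcast]
  have hg := strictGain_pos m
  have hx := eventually_La_le (s := s) hr ht (by omega)
    (x := m + 1 - h / (m.choose (m / 2) : ℝ) - strictGain m / 2) ?_ one_pos
  · have hlim : Tendsto (fun n : ℕ => (2 * ((r : ℝ) + t - 2) + 1) / (n : ℝ)) atTop (𝓝 0) :=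
      tendsto_const_div_atTop_nhds_zero_nat _
    filter_upwards [hx, hlim.eventually_le_const (half_pos hg)] with n h1 h2
    refine h1.trans (mul_le_mul_of_nonneg_right ?_ (Nat.cast_nonneg _))
    linarith
  · filter_upwards [eventually_card_filter_small_le (δ := 1 / 4) (by norm_num) (half_pos hg),
      eventually_ge_atTop (8 * m + 1)] with n hn hnm F hF
    have hn1 : (1 : ℝ) ≤ n := by exact_mod_cast (by omega : 1 ≤ n)
    set H := F \ (lowPart F r ∪ highPart F t) with hH
    set H₁ := H.filter fun A => #A + 2 * m ≤ n with hH₁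
    set H₂ := H.filter fun A => ¬ #A + 2 * m ≤ n with hH₂
    have hsplit : (#H : ℝ) = #H₁ + #H₂ := by
      rw [hH₁, hH₂]
      exact_mod_cast (card_filter_add_card_filter_not (s := H) _).symm
    have h1 := card_le_of_card_Ioo_inter_le (H := H₁) (h := h) hm (by omega) (by omega)
      (fun A hA => by rw [Fintype.card_fin]; exact (mem_filter.1 hA).2)
      (fun A hA B hB hAB => card_Ioo_inter_middlePart hs hsm hF (filter_subset _ _) hA hB hAB)
    rw [Fintype.card_fin] at h1
    -- These sets have complements of size less than `2 * m`, hence at most `n / 4` since `n > 8 *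
    -- m`.
    have h2 : (#H₂ : ℝ) ≤ strictGain m / 2 / n * n.choose (n / 2) := by
      refine le_trans ?_ hn
      rw [← card_image_of_injective H₂ compl_injective]
      norm_cast
      refine card_le_card fun A hA => ?_
      obtain ⟨B, hB, rfl⟩ := mem_image.1 hA
      have h3 := (mem_filter.1 hB).2
      refine mem_filter.2 ⟨mem_univ _, ?_⟩
      rw [card_compl, Fintype.card_fin]
      have h4 : 4 * (n - #B) ≤ n := by omega
      have h4' : 4 * ((n - #B : ℕ) : ℝ) ≤ n := by exact_mod_cast h4
      linarith
    have h5 : strictGain m / 2 / n * n.choose (n / 2) ≤ strictGain m / 2 * n.choose (n / 2) := by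
      refine mul_le_mul_of_nonneg_right ?_ (Nat.cast_nonneg _)
      exact div_le_self (half_pos hg).le hn1
    rw [hsplit]
    linarith

end Upper

/-! ### The lower bound construction by element sums modulo `n`. -/

section Construction

open Finset

/-- The sum modulo `n` of the elements of a subset of `{0, …, n - 1}`. -/
def residueSum {n : ℕ} (A : Finset (Fin n)) : ZMod n := ∑ x ∈ A, ((x : ℕ) : ZMod n)

/-- The sets of size `l` whose residue sum is one of `a, a + 1, …, a + q - 1`. -/
def residueLayer (n l q : ℕ) (a : ZMod n) : Finset (Finset (Fin n)) :=
  univ.filter fun A => #A = l ∧ (residueSum A - a).val < q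

lemma natCast_fin_injective {n : ℕ} {x y : Fin n} (h : ((x : ℕ) : ZMod n) = ((y : ℕ) : ZMod n)) :
    x = y := by
  rw [ZMod.natCast_eq_natCast_iff', Nat.mod_eq_of_lt x.2, Nat.mod_eq_of_lt y.2] at h
  exact Fin.ext h

lemma exists_eq_insert_of_card {n : ℕ} {D A : Finset (Fin n)} (h : D ⊆ A) (hc : #A = #D + 1) :
    ∃ x ∉ D, A = insert x D := by
  obtain ⟨x, hx⟩ := card_eq_one.1 (show #(A \ D) = 1 by rw [card_sdiff_of_subset h]; omega)
  have hx' : x ∈ A \ D := by rw [hx]; exact mem_singleton_self x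
  exact ⟨x, (Finset.mem_sdiff.1 hx').2, by rw [insert_eq, ← hx, sdiff_union_of_subset h]⟩

lemma residueSum_insert {n : ℕ} {D : Finset (Fin n)} {x : Fin n} (hx : x ∉ D) :
    residueSum (insert x D) = ((x : ℕ) : ZMod n) + residueSum D := sum_insert hx

lemma val_sub_injective {n : ℕ} [NeZero n] {x y a : ZMod n} (h : (x - a).val = (y - a).val) :
    x = y := by
  have := ZMod.val_injective n h
  exact sub_left_injective this

/-- Adding different elements to `D` gives different sums modulo `n`, and only `q` residues are
allowed. -/
lemma card_residueLayer_above_le {n l q : ℕ} [NeZero n] (a : ZMod n) {D : Finset (Fin n)}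
    (hD : #D = l) : #((residueLayer n (l + 1) q a).filter fun A => D ⊆ A) ≤ q := by
  refine (card_le_card_of_injOn (t := range q) (fun A => (residueSum A - a).val) ?_ ?_).trans_eq
    (card_range q)
  · intro A hA
    rw [mem_coe, mem_filter, residueLayer, mem_filter] at hA
    exact mem_coe.2 (mem_range.2 hA.1.2.2)
  · intro A hA B hB hAB
    rw [mem_coe, mem_filter, residueLayer, mem_filter] at hA hB
    have h := val_sub_injective hAB
    obtain ⟨x, hx, rfl⟩ := exists_eq_insert_of_card hA.2 (by omega)
    obtain ⟨y, hy, rfl⟩ := exists_eq_insert_of_card hB.2 (by omega)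
    rw [residueSum_insert hx, residueSum_insert hy, add_left_inj] at h
    rw [natCast_fin_injective h]

lemma card_residueLayer_below_le {n l q : ℕ} [NeZero n] (a : ZMod n) {D : Finset (Fin n)}
    (hD : #D = l + 1) : #((residueLayer n l q a).filter fun A => A ⊆ D) ≤ q := by
  refine (card_le_card_of_injOn (t := range q) (fun A => (residueSum A - a).val) ?_ ?_).trans_eq
    (card_range q)
  · intro A hA
    rw [mem_coe, mem_filter, residueLayer, mem_filter] at hA
    exact mem_coe.2 (mem_range.2 hA.1.2.2)
  · intro A hA B hB hAB
    rw [mem_coe, mem_filter, residueLayer, mem_filter] at hA hB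
    have h := val_sub_injective hAB
    obtain ⟨x, hx, hxD⟩ := exists_eq_insert_of_card hA.2 (by omega)
    obtain ⟨y, hy, hyD⟩ := exists_eq_insert_of_card hB.2 (by omega)
    have h1 : residueSum (insert x A) = residueSum (insert y B) := by rw [← hxD, ← hyD]
    rw [residueSum_insert hx, residueSum_insert hy, h, add_left_inj] at h1
    have h2 := natCast_fin_injective h1
    rw [← erase_insert hx, ← erase_insert hy, ← hxD, ← hyD, h2]

/-- Averaging over the `n` positions of the window: each set of size `l` is caught by exactly `q` of
them. -/
lemma exists_card_residueLayer_ge {n l q : ℕ} [NeZero n] (hq : q ≤ n) :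
    ∃ a : ZMod n, q * n.choose l ≤ n * #(residueLayer n l q a) := by
  have hval : #(univ.filter fun b : ZMod n => b.val < q) = q := by
    rw [← card_image_of_injective _ (ZMod.val_injective n)]
    conv_rhs => rw [← card_range q]
    congr 1
    ext i
    simp only [mem_image, mem_filter, mem_univ, true_and, mem_range]
    constructor
    · rintro ⟨b, hb, rfl⟩; exact hb
    · intro hi
      have := ZMod.val_natCast_of_lt (n := n) (a := i) (by omega)
      exact ⟨(i : ZMod n), by rwa [this], this⟩
  have hshift : ∀ x : ZMod n, #(univ.filter fun a : ZMod n => (x - a).val < q) = q := by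
    intro x
    conv_rhs => rw [← hval]
    refine card_bij' (fun a _ => x - a) (fun b _ => x - b) ?_ ?_ ?_ ?_ <;> simp
  have hsum : ∑ a : ZMod n, #(residueLayer n l q a) = n.choose l * q := by
    have h1 : ∀ a ∈ (univ : Finset (ZMod n)), #(residueLayer n l q a)
        = ∑ A ∈ powersetCard l (univ : Finset (Fin n)),
          if (residueSum A - a).val < q then 1 else 0 := by
      intro a _
      rw [sum_boole, residueLayer, Nat.cast_id]
      congr 1
      ext A
      simp [mem_powersetCard]
    rw [sum_congr rfl h1, sum_comm]
    have h2 : ∀ A ∈ powersetCard l (univ : Finset (Fin n)),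
        (∑ a : ZMod n, if (residueSum A - a).val < q then 1 else 0) = q := by
      intro A _
      rw [sum_boole, Nat.cast_id, hshift]
    rw [sum_congr rfl h2, sum_const, card_powersetCard, card_univ, Fintype.card_fin, smul_eq_mul]
  by_contra hcon
  push Not at hcon
  have h3 : ∑ a : ZMod n, n * #(residueLayer n l q a) < ∑ _a : ZMod n, q * n.choose l :=
    sum_lt_sum_of_nonempty univ_nonempty fun a _ => hcon a
  rw [← mul_sum, hsum, sum_const, card_univ, ZMod.card, smul_eq_mul] at h3
  exact absurd h3 (by rw [mul_comm q]; exact lt_irrefl _)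

/-- The `k` levels `j + 1, …, j + k` extended by parts of the two adjacent levels. -/
def extendedLevels (n j k p q : ℕ) (a b : ZMod n) : Finset (Finset (Fin n)) :=
  consecutiveLevels n j k ∪ (residueLayer n j p a ∪ residueLayer n (j + k + 1) q b)

lemma mem_extendedLevels {n j k p q : ℕ} {a b : ZMod n} {A : Finset (Fin n)} :
    A ∈ extendedLevels n j k p q a b ↔ (j + 1 ≤ #A ∧ #A ≤ j + k) ∨
      A ∈ residueLayer n j p a ∨ A ∈ residueLayer n (j + k + 1) q b := by
  rw [extendedLevels, mem_union, mem_union, consecutiveLevels, mem_filter]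
  refine or_congr_left ?_
  simp only [mem_univ, true_and]
  omega

lemma card_of_mem_residueLayer {n l q : ℕ} {a : ZMod n} {A : Finset (Fin n)}
    (h : A ∈ residueLayer n l q a) : #A = l := (mem_filter.1 h).2.1

lemma residueLayer_zero (n l : ℕ) (a : ZMod n) : residueLayer n l 0 a = ∅ := by
  simp [residueLayer]

/-- If `t ≥ 2` sets had a common subset `D` of size `j + k`, each would be `D` itself or one of the
at most `t - 2` sets of the upper layer above `D`, giving at most `t - 1`. For `t = 1` the truncated
`t - 2` is 0 and the upper layer is empty. -/
lemma card_inf_add_le {n j k p t : ℕ} [NeZero n] (ht : 1 ≤ t) {a b : ZMod n}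
    {Z : Finset (Finset (Fin n))} (hZ : Z ⊆ extendedLevels n j k p (t - 2) a b) (hc : #Z = t)
    (hZj : ∀ z ∈ Z, j < #z) :
    #(Z.inf id) + (if t = 1 then 0 else 1) ≤ j + k := by
  split_ifs with h1
  · subst h1
    obtain ⟨z, rfl⟩ := card_eq_one.1 hc
    have hz := mem_extendedLevels.1 (hZ (mem_singleton_self z))
    have hj := hZj z (mem_singleton_self z)
    rw [inf_singleton, id]
    rcases hz with hz | hz | hz
    · exact hz.2
    · have := card_of_mem_residueLayer hz; omega
    · rw [show 1 - 2 = 0 from rfl, residueLayer_zero] at hz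
      simp at hz
  · by_contra hcon
    push Not at hcon
    obtain ⟨D, hD, hDc⟩ := exists_subset_card_eq (show j + k ≤ #(Z.inf id) by omega)
    have hsub : Z ⊆ insert D ((residueLayer n (j + k + 1) (t - 2) b).filter fun A => D ⊆ A) := by
      intro z hz
      have hDz : D ⊆ z := hD.trans (inf_le (f := id) hz)
      rw [mem_insert, mem_filter]
      rcases mem_extendedLevels.1 (hZ hz) with h | h | h
      · left
        exact (eq_of_subset_of_card_le hDz (by omega)).symm
      · have := card_of_mem_residueLayer h
        have := hZj z hz
        omega
      · exact Or.inr ⟨h, hDz⟩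
    have h2 := (card_le_card hsub).trans (card_insert_le _ _)
    have h3 := card_residueLayer_above_le (q := t - 2) b hDc
    omega

lemma le_card_sup {n j k r q : ℕ} [NeZero n] (hjn : j + 1 ≤ n) (hr : 1 ≤ r) {a b : ZMod n}
    {X : Finset (Finset (Fin n))} (hX : X ⊆ extendedLevels n j k (r - 2) q a b) (hc : #X = r)
    (hXj : ∀ x ∈ X, #x ≤ j + k) :
    j + 1 + (if r = 1 then 0 else 1) ≤ #(X.sup id) := by
  split_ifs with h1
  · subst h1
    obtain ⟨x, rfl⟩ := card_eq_one.1 hc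
    have hx := mem_extendedLevels.1 (hX (mem_singleton_self x))
    have hj := hXj x (mem_singleton_self x)
    rw [sup_singleton, id]
    rcases hx with hx | hx | hx
    · exact hx.1
    · rw [show 1 - 2 = 0 from rfl, residueLayer_zero] at hx
      simp at hx
    · have := card_of_mem_residueLayer hx; omega
  · by_contra hcon
    push Not at hcon
    obtain ⟨D, hD, hDc⟩ := exists_superset_card_eq (show #(X.sup id) ≤ j + 1 by omega)
      (by rwa [Fintype.card_fin])
    have hsub : X ⊆ insert D ((residueLayer n j (r - 2) a).filter fun A => A ⊆ D) := by
      intro x hx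
      have hxD : x ⊆ D := (le_sup (f := id) hx).trans hD
      rw [mem_insert, mem_filter]
      rcases mem_extendedLevels.1 (hX hx) with h | h | h
      · left
        exact eq_of_subset_of_card_le hxD (by omega)
      · exact Or.inr ⟨h, hxD⟩
      · have := card_of_mem_residueLayer h
        have := hXj x hx
        omega
    have h2 := (card_le_card hsub).trans (card_insert_le _ _)
    have h3 := card_residueLayer_below_le (q := r - 2) a hDc
    omega

/-- The middle sets lie between the union of the bottom and the intersection of the top. If `r = 1`
the union is the bottom set itself and is unavailable, and likewise for `t = 1`. So this interval
has at least `s + 2 - f r t > 2 ^ (m - 1)` elements. -/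
lemma card_sup_add_lt_card_inf {n r s t m : ℕ} (hs : f r t + 2 ≤ s)
    (hsm : 2 ^ (m - 1) + f r t ≤ s + 1) {X Y Z : Finset (Finset (Fin n))} (hXc : #X = r)
    (hYc : #Y = s) (hZc : #Z = t) (hXY : ∀ x ∈ X, ∀ y ∈ Y, x ⊂ y)
    (hYZ : ∀ y ∈ Y, ∀ z ∈ Z, y ⊂ z) : #(X.sup id) + (m - 1) < #(Z.inf id) := by
  by_contra! hlt
  obtain ⟨y₀, hy₀⟩ := card_pos.1 (show 0 < #Y by omega)
  set U := X.sup id with hU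
  set I := Z.inf id with hI
  have hUY : ∀ y ∈ Y, U ⊆ y := fun y hy => Finset.sup_le fun x hx => (hXY x hx y hy).1
  have hYI : ∀ y ∈ Y, y ⊆ I := fun y hy => Finset.le_inf fun z hz => (hYZ y hy z hz).1
  have hUne : r = 1 → ∀ y ∈ Y, U ⊂ y := by
    intro hr1 y hy
    obtain ⟨x, rfl⟩ := card_eq_one.1 (hXc.trans hr1)
    rw [hU, sup_singleton]
    exact hXY x (mem_singleton_self x) y hy
  have hIne : t = 1 → ∀ y ∈ Y, y ⊂ I := by
    intro ht1 y hy
    obtain ⟨z, rfl⟩ := card_eq_one.1 (hZc.trans ht1)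
    rw [hI, inf_singleton]
    exact hYZ y hy z (mem_singleton_self z)
  have hUI : U ⊆ I := (hUY y₀ hy₀).trans (hYI y₀ hy₀)
  have hcard := card_Icc_finset hUI
  have hpow : 2 ^ (#I - #U) ≤ 2 ^ (m - 1) :=
    Nat.pow_le_pow_right two_pos (by omega)
  set E : Finset (Finset (Fin n)) :=
    (if r = 1 then {U} else ∅) ∪ ((if t = 1 then {I} else ∅) ∪ Y) with hE
  have hEsub : E ⊆ Icc U I := by
    refine union_subset ?_ (union_subset ?_ ?_)
    · split_ifs <;> simp [hUI]
    · split_ifs <;> simp [hUI]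
    · exact fun y hy => mem_Icc.2 ⟨hUY y hy, hYI y hy⟩
  have hEcard : #E + f r t = s + 2 := by
    rw [hE, card_union_of_disjoint, card_union_of_disjoint, f_eq]
    · split_ifs <;> simp <;> omega
    · split_ifs with h
      · rw [disjoint_singleton_left]
        exact fun hIY => (hIne h I hIY).ne rfl
      · exact disjoint_empty_left _
    · split_ifs with h h'
      · rw [disjoint_singleton_left, mem_union, mem_singleton]
        rintro (hUI' | hUY')
        · exact ((hUne h y₀ hy₀).trans (hIne h' y₀ hy₀)).ne hUI'
        · exact (hUne h U hUY').ne rfl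
      · rw [disjoint_singleton_left, empty_union]
        exact fun hUY' => (hUne h U hUY').ne rfl
      · exact disjoint_empty_left _
      · exact disjoint_empty_left _
  have := card_le_card hEsub
  omega

/-- The union of the bottom and the intersection of the top lose `f r t` levels in total, leaving a
size difference of at most `m - 1`, against `card_sup_add_lt_card_inf`. -/
lemma posetFree_extendedLevels {n j r s t m : ℕ} [NeZero n] (hjn : j + 1 ≤ n) (hr : 1 ≤ r)
    (ht : 1 ≤ t) (hm : 1 ≤ m) (hs : f r t + 2 ≤ s) (hsm : 2 ^ (m - 1) + f r t ≤ s + 1)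
    (a b : ZMod n) :
    PosetFree (extendedLevels n j (m + f r t) (r - 2) (t - 2) a b) (K r s t) := by
  rw [PosetFree, containsPoset_K_iff (by omega)]
  rintro ⟨X, Y, Z, hX, hY, hZ, hXc, hYc, hZc, hXY, hYZ⟩
  obtain ⟨y₀, hy₀⟩ := card_pos.1 (show 0 < #Y by omega)
  have hbounds : ∀ A ∈ extendedLevels n j (m + f r t) (r - 2) (t - 2) a b,
      j ≤ #A ∧ #A ≤ j + (m + f r t) + 1 := by
    intro A hA
    rcases mem_extendedLevels.1 hA with h | h | h
    · omega
    · have := card_of_mem_residueLayer h; omega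
    · have := card_of_mem_residueLayer h; omega
  have h1 := card_inf_add_le ht hZ hZc fun z hz => by
    have h1 := card_lt_card (hYZ y₀ hy₀ z hz)
    have h2 := hbounds y₀ (hY hy₀)
    omega
  have h2 := le_card_sup hjn hr hX hXc fun x hx => by
    have h1 := card_lt_card (hXY x hx y₀ hy₀)
    have h2 := hbounds y₀ (hY hy₀)
    omega
  have h3 := card_sup_add_lt_card_inf hs hsm hXc hYc hZc hXY hYZ
  rw [f_eq] at h1
  split_ifs at h1 h2 <;> omega

/-- Same contradiction without the residue layers: of two distinct sets, at least one is strictly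
inside their union, and dually. This version covers negative `j` and `n = 0`, as `HasE` requires. -/
lemma posetFree_consecutiveLevels {r s t m : ℕ} (hr : 1 ≤ r) (ht : 1 ≤ t) (hm : 1 ≤ m)
    (hs : f r t + 2 ≤ s) (hsm : 2 ^ (m - 1) + f r t ≤ s + 1) (j : ℤ) (n : ℕ) :
    PosetFree (consecutiveLevels n j (m + f r t)) (K r s t) := by
  rw [PosetFree, containsPoset_K_iff (by omega)]
  rintro ⟨X, Y, Z, hX, -, hZ, hXc, hYc, hZc, hXY, hYZ⟩
  have hbounds : ∀ A ∈ consecutiveLevels n j (m + f r t),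
      j + 1 ≤ #A ∧ (#A : ℤ) ≤ j + (m + f r t : ℕ) := fun A hA => (mem_filter.1 hA).2
  have h1 : (#(Z.inf id) : ℤ) + (if t = 1 then 0 else 1 : ℕ) ≤ j + (m + f r t : ℕ) := by
    split_ifs with h
    · obtain ⟨z, rfl⟩ := card_eq_one.1 (hZc.trans h)
      simpa using (hbounds z (hZ (mem_singleton_self z))).2
    · obtain ⟨z, hz, z', hz', hne⟩ := one_lt_card.1 (show 1 < #Z by omega)
      have hIz : Z.inf id ⊆ z := inf_le (f := id) hz
      have hIz' : Z.inf id ⊆ z' := inf_le (f := id) hz'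
      have h2 := (hbounds z (hZ hz)).2
      have h3 := (hbounds z' (hZ hz')).2
      have h4 : #(Z.inf id) < #z ∨ #(Z.inf id) < #z' := by
        by_contra! hcon
        exact hne ((eq_of_subset_of_card_le hIz hcon.1).symm.trans
          (eq_of_subset_of_card_le hIz' hcon.2))
      omega
  have h2 : j + 1 + (if r = 1 then 0 else 1 : ℕ) ≤ (#(X.sup id) : ℤ) := by
    split_ifs with h
    · obtain ⟨x, rfl⟩ := card_eq_one.1 (hXc.trans h)
      simpa using (hbounds x (hX (mem_singleton_self x))).1
    · obtain ⟨x, hx, x', hx', hne⟩ := one_lt_card.1 (show 1 < #X by omega)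
      have hxU : x ⊆ X.sup id := le_sup (f := id) hx
      have hxU' : x' ⊆ X.sup id := le_sup (f := id) hx'
      have h2 := (hbounds x (hX hx)).1
      have h3 := (hbounds x' (hX hx')).1
      have h4 : #x < #(X.sup id) ∨ #x' < #(X.sup id) := by
        by_contra! hcon
        exact hne ((eq_of_subset_of_card_le hxU hcon.1).trans
          (eq_of_subset_of_card_le hxU' hcon.2).symm)
      omega
  have h3 := card_sup_add_lt_card_inf hs hsm hXc hYc hZc hXY hYZ
  rw [f_eq] at h1
  split_ifs at h1 h2 <;> omega

lemma card_extendedLevels {n j k p q : ℕ} (a b : ZMod n) :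
    #(extendedLevels n j k p q a b)
      = #(consecutiveLevels n j k) + (#(residueLayer n j p a) + #(residueLayer n (j + k + 1) q b)) := by
  have hdis : ∀ A : Finset (Fin n), A ∈ consecutiveLevels n j k → j + 1 ≤ #A ∧ #A ≤ j + k := by
    intro A hA
    rw [consecutiveLevels, mem_filter] at hA
    omega
  rw [extendedLevels, card_union_of_disjoint, card_union_of_disjoint]
  · rw [disjoint_left]
    intro A h1 h2
    have := card_of_mem_residueLayer h1
    have := card_of_mem_residueLayer h2
    omega
  · rw [disjoint_left]
    intro A h1 h2
    have h3 := hdis A h1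
    rcases mem_union.1 h2 with h | h
    · have := card_of_mem_residueLayer h; omega
    · have := card_of_mem_residueLayer h; omega

lemma max_zero_sub_two (r : ℕ) (hr : 1 ≤ r) : max 0 ((r : ℝ) - 2) = ((r - 2 : ℕ) : ℝ) := by
  rcases le_or_gt 2 r with h | h
  · rw [Nat.cast_sub h, max_eq_right]
    · norm_num
    · have : (2 : ℝ) ≤ r := by exact_mod_cast h
      linarith
  · obtain rfl : r = 1 := by omega
    norm_num

lemma lowerBound_of_le {r s t m : ℕ} (hr : 1 ≤ r) (ht : 1 ≤ t) (hm : 1 ≤ m) (hs : f r t + 2 ≤ s)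
    (hsm : 2 ^ (m - 1) + f r t ≤ s + 1) : LowerBound r s t (m + f r t) := by
  unfold LowerBound
  rw [max_zero_sub_two r hr, max_zero_sub_two t ht]
  set k := m + f r t with hk
  set p := r - 2 with hp
  set q := t - 2 with hq
  set n₀ := k + 2 + p + q with hn₀
  set d : ℝ := 2 * (k + 2 : ℕ) * ((k + 2 : ℕ) + 1) with hd
  have hd0 : 0 ≤ d := by positivity
  -- The first summand is the loss from the adjacent levels not being exactly the middle one; the
  -- second makes the left side nonpositive when `n < n₀`, where the construction may not fit.
  refine ⟨(p + q) * d + n₀ ^ 2 * (k + p + q), fun n hn => ?_⟩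
  rw [choose_half_succ]
  have hn0 : (0 : ℝ) < n := by exact_mod_cast hn
  have hn1 : (1 : ℝ) ≤ n := by exact_mod_cast hn
  set c := (n.choose (n / 2) : ℝ) with hc
  have hc0 : 0 ≤ c := Nat.cast_nonneg _
  rcases lt_or_ge n n₀ with hlt | hge
  · have h1 : (sigmaSum n k : ℝ) ≤ k * c := by
      rw [hc]; exact_mod_cast sigmaSum_le n k
    have h2 : (k : ℝ) + ((p : ℝ) + q) / n ≤ ((p + q) * d + n₀ ^ 2 * (k + p + q)) / n ^ 2 := by
      rw [le_div_iff₀ (by positivity)]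
      have h3 : (n : ℝ) ≤ n₀ := by exact_mod_cast hlt.le
      have h4 : ((p : ℝ) + q) / n * n ^ 2 = (p + q) * n := by field_simp
      have h5 : (n : ℝ) ^ 2 ≤ (n₀ : ℝ) ^ 2 := pow_le_pow_left₀ hn0.le h3 2
      have h6 : (n : ℝ) ≤ (n₀ : ℝ) ^ 2 := by nlinarith
      have h7 : 0 ≤ ((p : ℝ) + q) * d := by positivity
      have h8 : (0 : ℝ) ≤ (p : ℝ) + q := by positivity
      have h9 : (0 : ℝ) ≤ k := Nat.cast_nonneg _
      nlinarith [mul_le_mul_of_nonneg_left h5 h9, mul_le_mul_of_nonneg_left h6 h8]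
    have h3 : (0 : ℝ) ≤ (La n (K r s t) : ℝ) := Nat.cast_nonneg _
    nlinarith [mul_le_mul_of_nonneg_right h2 hc0]
  · have : NeZero n := ⟨by omega⟩
    set j := (n - k) / 2 with hj
    obtain ⟨a, ha⟩ := exists_card_residueLayer_ge (n := n) (l := j) (q := p) (by omega)
    obtain ⟨b, hb⟩ := exists_card_residueLayer_ge (n := n) (l := j + k + 1) (q := q) (by omega)
    have hfree := posetFree_extendedLevels (n := n) (j := j) (by omega) hr ht hm hs hsm a b
    have hle := card_le_La hfree
    rw [card_extendedLevels, card_consecutiveLevels] at hle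
    have hsig : ∑ i ∈ Icc 1 k, chooseInt n ((j : ℤ) + i) = sigmaSum n k := by
      unfold sigmaSum
      refine sum_congr rfl fun i _ => ?_
      rw [show ((n : ℤ) - k) / 2 = j by omega]
    rw [hsig] at hle
    have h1 := choose_near_middle_ge (n := n) (j := j) (a := k + 2) (by omega) (by omega) (by omega)
    have h2 := choose_near_middle_ge (n := n) (j := j + k + 1) (a := k + 2) (by omega) (by omega)
      (by omega)
    rw [← hd, ← hc] at h1 h2
    have ha' : (p : ℝ) * n.choose j ≤ n * #(residueLayer n j p a) := by exact_mod_cast ha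
    have hb' : (q : ℝ) * n.choose (j + k + 1) ≤ n * #(residueLayer n (j + k + 1) q b) := by
      exact_mod_cast hb
    have hle' : (sigmaSum n k : ℝ) + (#(residueLayer n j p a) + #(residueLayer n (j + k + 1) q b))
        ≤ La n (K r s t) := by exact_mod_cast hle
    have hpart : ∀ (p : ℕ) (x y : ℝ), (p : ℝ) * x ≤ n * y → (n - d) * c ≤ n * x →
        (p / n - p * d / n ^ 2) * c ≤ y := by
      intro p x y h3 h4
      have h5 : (p : ℝ) / n - p * d / n ^ 2 = p * (n - d) / n ^ 2 := by field_simp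
      rw [h5, div_mul_eq_mul_div, div_le_iff₀ (by positivity)]
      have h6 := mul_le_mul_of_nonneg_left h4 (Nat.cast_nonneg (α := ℝ) p)
      have h7 := mul_le_mul_of_nonneg_left h3 hn0.le
      nlinarith
    have e1 := hpart p _ _ ha' h1
    have e2 := hpart q _ _ hb' h2
    have e3 : ((p : ℝ) + q) / n - ((p + q) * d + n₀ ^ 2 * (k + p + q)) / n ^ 2
        = (p / n - p * d / n ^ 2) + (q / n - q * d / n ^ 2) - n₀ ^ 2 * (k + p + q) / n ^ 2 := by
      ring
    have e4 : 0 ≤ (n₀ : ℝ) ^ 2 * (k + p + q) / n ^ 2 * c := by positivity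
    rw [e3]
    nlinarith

end Construction

/-! ### The limit, the value of `e`, and the little-o form of the error. -/

section Limits

lemma choose_middle_pos (n : ℕ) : (0 : ℝ) < n.choose (n / 2) := by
  exact_mod_cast Nat.choose_pos (Nat.div_le_self _ _)

lemma tendsto_one_sub_div (x : ℝ) : Tendsto (fun n : ℕ => 1 - x / (n : ℝ)) atTop (𝓝 1) := by
  simpa using (tendsto_const_div_atTop_nhds_zero_nat x).const_sub 1

lemma sigmaSum_div_ge {n k : ℕ} (hn : 1 ≤ n) (hk : k ≤ n) :
    (k : ℝ) * (1 - 2 * k * (k + 1) / n) ≤ sigmaSum n k / n.choose (n / 2) := by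
  have hn0 : (0 : ℝ) < n := by exact_mod_cast hn
  have h := sigmaSum_ge hk
  rw [le_div_iff₀ (choose_middle_pos n)]
  have h1 : (1 : ℝ) - 2 * k * (k + 1) / n = (n - 2 * k * (k + 1)) / n := by field_simp
  rw [h1, mul_div_assoc', div_mul_eq_mul_div, div_le_iff₀ hn0]
  linarith

lemma hasPi_of_bounds {r s t k : ℕ} (hlow : LowerBound r s t k)
    (hup : ∀ᶠ n : ℕ in atTop, (La n (K r s t) : ℝ)
      ≤ (k + (2 * ((r : ℝ) + t - 2) + 1) / n) * n.choose (n / 2)) : HasPi (K r s t) k := by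
  obtain ⟨C, hC⟩ := hlow
  set P := max 0 ((r : ℝ) - 2) + max 0 ((t : ℝ) - 2) with hP
  have hl : Tendsto (fun n : ℕ => (k : ℝ) * (1 - 2 * k * (k + 1) / (n : ℝ))
      + (P / n - C / (n : ℝ) ^ 2)) atTop (𝓝 (k : ℝ)) := by
    have h1 := (tendsto_one_sub_div (2 * k * (k + 1))).const_mul (k : ℝ)
    have h2 := tendsto_const_div_atTop_nhds_zero_nat P
    have h3 := tendsto_const_div_pow C 2 (by norm_num)
    simpa using h1.add (h2.sub h3)
  have hu : Tendsto (fun n : ℕ => (k : ℝ) + (2 * ((r : ℝ) + t - 2) + 1) / (n : ℝ)) atTop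
      (𝓝 (k : ℝ)) := by
    simpa using (tendsto_const_div_atTop_nhds_zero_nat (2 * ((r : ℝ) + t - 2) + 1)).const_add
      (k : ℝ)
  refine tendsto_of_tendsto_of_tendsto_of_le_of_le' hl hu ?_ ?_
  · filter_upwards [eventually_ge_atTop 1, eventually_ge_atTop k] with n hn hk
    have h1 := hC n hn
    rw [choose_half_succ] at h1
    have h2 := sigmaSum_div_ge hn hk
    have h3 := div_le_div_of_nonneg_right h1 (choose_middle_pos n).le
    rw [add_div, mul_div_cancel_right₀ _ (choose_middle_pos n).ne'] at h3
    linarith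
  · filter_upwards [hup] with n hn
    rwa [div_le_iff₀ (choose_middle_pos n)]

lemma PosetFree.mono {n : ℕ} {F G : Finset (Finset (Fin n))} {P : Type} [PartialOrder P]
    (hG : PosetFree G P) (h : F ⊆ G) : PosetFree F P := by
  rintro ⟨i, hi, hmono⟩
  exact hG ⟨fun p => ⟨i p, h (i p).2⟩, fun p q hpq => hi (Subtype.ext (Subtype.mk.inj hpq)),
    hmono⟩

/-- If more than `k` consecutive levels were always free, the `k + 1` central ones would force the
limit to be at least `k + 1`. -/
lemma hasE_of_hasPi {P : Type} [PartialOrder P] {k : ℕ} (hpi : HasPi P k)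
    (hfree : ∀ (j : ℤ) (n : ℕ), PosetFree (consecutiveLevels n j k) P) : HasE P k := by
  refine ⟨hfree, fun l hl => ?_⟩
  by_contra! hlt
  have h1 : Tendsto (fun n : ℕ => ((k + 1 : ℕ) : ℝ)
      * (1 - 2 * (k + 1 : ℕ) * ((k + 1 : ℕ) + 1) / (n : ℝ))) atTop (𝓝 ((k + 1 : ℕ) : ℝ)) := by
    simpa using (tendsto_one_sub_div (2 * (k + 1 : ℕ) * ((k + 1 : ℕ) + 1))).const_mul
      ((k + 1 : ℕ) : ℝ)
  have h2 := le_of_tendsto_of_tendsto h1 hpi ?_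
  · push_cast at h2
    linarith
  · filter_upwards [eventually_ge_atTop (k + 1)] with n hn
    refine (sigmaSum_div_ge (by omega) hn).trans ?_
    refine div_le_div_of_nonneg_right ?_ (choose_middle_pos n).le
    have h3 : PosetFree (consecutiveLevels n (((n : ℤ) - (k + 1 : ℕ)) / 2) (k + 1)) P := by
      refine (hl (((n : ℤ) - (k + 1 : ℕ)) / 2) n).mono fun A hA => ?_
      rw [consecutiveLevels, Finset.mem_filter] at hA ⊢
      exact ⟨hA.1, hA.2.1, hA.2.2.trans (by omega)⟩
    have h4 : sigmaSum n (k + 1) ≤ La n P := by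
      rw [sigmaSum, ← card_consecutiveLevels]
      exact card_le_La h3
    exact_mod_cast h4

/-- The error function is the positive part of the actual excess, which makes the inequality hold
for every `n`, not only eventually. -/
lemma exists_isLittleO_of_eventually_le {u v w : ℕ → ℝ} (hw : ∀ n, 0 < w n)
    (h : ∀ ε : ℝ, 0 < ε → ∀ᶠ n : ℕ in atTop, u n ≤ (v n + ε / n) * w n) :
    ∃ ε : ℕ → ℝ, ε =o[atTop] (fun n : ℕ => 1 / (n : ℝ)) ∧ ∀ n, u n ≤ (v n + ε n) * w n := by
  refine ⟨fun n => max 0 (u n / w n - v n), ?_, fun n => ?_⟩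
  · rw [isLittleO_iff]
    intro ε hε
    filter_upwards [h ε hε] with n hn
    rw [← div_le_iff₀ (hw n)] at hn
    have h0 : 0 ≤ ε / (n : ℝ) := by positivity
    rw [Real.norm_of_nonneg (le_max_left _ _), Real.norm_of_nonneg (by positivity), mul_one_div]
    exact max_le h0 (by linarith)
  · rw [← div_le_iff₀ (hw n)]
    have := le_max_right 0 (u n / w n - v n)
    linarith

end Limits

/-! ### Assembly of the two parts. -/

theorem theorem1p9 (r s t : ℕ) (hr : 1 ≤ r) (ht : 1 ≤ t) (hs : 2 ≤ (s : ℤ) - (f r t : ℤ)) :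
    -- part (1)
    (((s : ℤ) - (f r t : ℤ) ∈ Set.Icc ((2 : ℤ) ^ (mS r s t - 1) - 1)
        ((2 : ℤ) ^ mS r s t - ((mS r s t).choose ((mS r s t + 1) / 2) : ℤ) - 1)) →
      HasPi (K r s t) ((mS r s t : ℝ) + (f r t : ℝ)) ∧
      HasE (K r s t) (mS r s t + f r t) ∧
      LowerBound r s t (mS r s t + f r t) ∧
      ∃ ε : ℕ → ℝ, ε =o[atTop] (fun n : ℕ => 1 / (n : ℝ)) ∧
        ∀ n : ℕ, 1 ≤ n →
          (La n (K r s t) : ℝ) ≤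
            ((mS r s t : ℝ) + (f r t : ℝ) + 2 * ((r : ℝ) + (t : ℝ) - 2) / (n : ℝ) + ε n)
              * (n.choose ((n + 1) / 2) : ℝ)) ∧
    -- part (2)
    (((s : ℤ) - (f r t : ℤ) ∈ Set.Icc
        ((2 : ℤ) ^ mS r s t - ((mS r s t).choose ((mS r s t + 1) / 2) : ℤ))
        ((2 : ℤ) ^ mS r s t - 2)) →
      LowerBound r s t (mS r s t + f r t) ∧
      ∀ᶠ n : ℕ in atTop,
        (La n (K r s t) : ℝ) ≤
          ((mS r s t : ℝ) + (f r t : ℝ) + 1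
              - ((2 : ℝ) ^ mS r s t - (s : ℝ) + (f r t : ℝ) - 1)
                / ((mS r s t).choose ((mS r s t + 1) / 2) : ℝ))
            * (n.choose ((n + 1) / 2) : ℝ)) := by
  have hf : f r t ≤ 2 := by unfold f; split_ifs <;> omega
  have hs' : f r t + 2 ≤ s := by omega
  set m := mS r s t with hm_def
  -- The ceiling of the logarithm pins `s + 2 - f r t` between consecutive powers of 2: the lower
  -- one drives the construction, the upper one makes the missing count `h` positive.
  have hup : s + 2 - f r t ≤ 2 ^ m := Nat.le_pow_clog one_lt_two _
  have hlow : 2 ^ (m - 1) < s + 2 - f r t := Nat.pow_pred_clog_lt_self one_lt_two (by omega)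
  have hm : 2 ≤ m := by
    by_contra! h
    have : 2 ^ m ≤ 2 ^ 1 := Nat.pow_le_pow_right two_pos (by omega)
    omega
  have hLB : LowerBound r s t (m + f r t) :=
    lowerBound_of_le hr ht (by omega) hs' (by omega)
  rw [choose_half_succ m]
  refine ⟨fun hI => ?_, fun hI => ⟨hLB, ?_⟩⟩
  · have hM : s + m.choose (m / 2) + 1 ≤ 2 ^ m + f r t := by
      have h := hI.2
      have h2 : ((2 ^ m : ℕ) : ℤ) = 2 ^ m := by push_cast; rfl
      omega
    have hLa := fun ε (hε : (0 : ℝ) < ε) => eventually_La_le_of_middle_le hr ht hm hs' hM hε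
    have hpi : HasPi (K r s t) (m + f r t : ℕ) :=
      hasPi_of_bounds hLB (by simpa using hLa 1 one_pos)
    refine ⟨by simpa using hpi, hasE_of_hasPi hpi fun j n =>
      posetFree_consecutiveLevels hr ht (by omega) hs' (by omega) j n, hLB, ?_⟩
    obtain ⟨ε, hε, h⟩ := exists_isLittleO_of_eventually_le
      (u := fun n => (La n (K r s t) : ℝ)) (w := fun n => (n.choose (n / 2) : ℝ))
      (v := fun n => (m : ℝ) + f r t + 2 * ((r : ℝ) + t - 2) / n) choose_middle_pos
      fun ε hε => by
        filter_upwards [hLa ε hε] with n hn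
        refine hn.trans (le_of_eq ?_)
        ring
    refine ⟨ε, hε, fun n _ => ?_⟩
    rw [choose_half_succ n]
    exact h n
  · have hM : 2 ^ m + f r t ≤ s + m.choose (m / 2) := by
      have h := hI.1
      have h2 : ((2 ^ m : ℕ) : ℤ) = 2 ^ m := by push_cast; rfl
      omega
    filter_upwards [eventually_La_le_of_lt_middle hr ht hm hs' (by omega) hM] with n hn
    rw [choose_half_succ n]
    exact hn
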